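/- Notation: in any group $x^y = y^{-1}xy$, $[x,y] = x^{-1}y^{-1}xy$, and $x^{-y}=(x^{-1})^y$. The virtual braid group $VB_n$ is generated by $\sigma_1,\dots,\sigma_{n-1},\rho_1,\dots,\rho_{n-1}$ with the braid relations for the $\sigma_i$, the Coxeter relations of $S_n$ for the $\rho_i$ ($\rho_i^2=1$, $\rho_i\rho_{i+1}\rho_i=\rho_{i+1}\rho_i\rho_{i+1}$, $\rho_i\rho_j=\rho_j\rho_i$ for $|i-j|>1$), and $\sigma_i\rho_j=\rho_j\sigma_i$ for $|i-j|>1$, $\rho_i\rho_{i+1}\sigma_i=\sigma_{i+1}\rho_i\rho_{i+1}$. The virtual pure braid group $VP_n$ is the kernel of the homomorphism $VB_n\to S_n$ sending $\sigma_i$ and $\rho_i$ to the transposition $(i,i+1)$. In $VP_n$ put $\lambda_{i,i+1}=\rho_i\sigma_i^{-1}$, $\lambda_{i+1,i}=\sigma_i^{-1}\rho_i$ and, for $i+1<j$, $\lambda_{ij}=\rho_{j-1}\cdots\rho_{i+1}\lambda_{i,i+1}\rho_{i+1}\cdots\rho_{j-1}$, $\lambda_{ji}=\rho_{j-1}\cdots\rho_{i+1}\lambda_{i+1,i}\rho_{i+1}\cdots\rho_{j-1}$.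 In $VP_4$ put $$a_{11}=\lambda_{12},\quad a_{21}=\lambda_{13}\lambda_{23},\quad a_{12}=\lambda_{13}a_{11},\quad a_{31}=\lambda_{14}\lambda_{24}\lambda_{34},\quad a_{22}=\lambda_{14}\lambda_{24}a_{21},\quad a_{13}=\lambda_{14}a_{12},$$ $$b_{11}=\lambda_{21},\quad b_{21}=\lambda_{32}\lambda_{31},\quad b_{12}=b_{11}\lambda_{31},\quad b_{31}=\lambda_{43}\lambda_{42}\lambda_{41},\quad b_{22}=b_{21}\lambda_{42}\lambda_{41},\quad b_{13}=b_{12}\lambda_{41},$$ and $c_{ij}=b_{ij}a_{ij}$. **Theorem.** $VP_4$ is the HNN-extension with stable letter $a_{11}$, base group the subgroup $$G_4=\langle c_{11},a_{21},a_{12},c_{21},c_{12},a_{31},a_{22},a_{13},b_{31},b_{22},b_{13}\rangle$$ and associated subgroups $A=\langle\lambda_{34},\lambda_{24},\lambda_{14},\lambda_{43},\lambda_{42},\lambda_{41}\rangle$ and $B=A^{a_{11}}$, both contained in $G_4$, the isomorphism $A\to B$ being $x\mapsto x^{a_{11}}$. Here $$B=\big\langle a_{21}a_{22}^{-1}a_{31},\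 (a_{12}a_{13}^{-1}a_{22}a_{21}^{-1})^{a_{12}},\ (a_{13}a_{12}^{-1})^{a_{21}^{-1}a_{12}},\ b_{31}b_{22}^{-1}b_{21},\ (b_{21}^{-1}b_{22}b_{13}^{-1}b_{12})^{a_{12}},\ (b_{12}^{-1}b_{13})^{a_{21}^{-1}a_{12}}\big\rangle .$$ In the eleven generators above, $G_4$ is defined by the following relations, where $\varepsilon=\pm1$ and $c_{31},c_{22},c_{13}$ stand for the words $b_{31}a_{31},b_{22}a_{22},b_{13}a_{13}$: 1) conjugations by $c_{11}^{\varepsilon}$: $$a_{21}^{c_{11}^{\varepsilon}}=a_{21},\quad a_{12}^{c_{11}^{\varepsilon}}=a_{12}^{c_{12}^{\varepsilon}c_{21}^{-\varepsilon}},\quad c_{21}^{c_{11}^{\varepsilon}}=c_{21},\quad c_{12}^{c_{11}^{\varepsilon}}=c_{12}^{c_{21}^{-\varepsilon}},$$ $$a_{31}^{c_{11}^{\varepsilon}}=a_{31},\quad a_{22}^{c_{11}^{\varepsilon}}=a_{22},\quad a_{13}^{c_{11}^{\varepsilon}}=a_{13}^{c_{13}^{\varepsilon}c_{22}^{-\varepsilon}},\quad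 b_{31}^{c_{11}^{\varepsilon}}=b_{31},\quad b_{22}^{c_{11}^{\varepsilon}}=b_{22},\quad b_{13}^{c_{11}^{\varepsilon}}=b_{13}^{c_{13}^{\varepsilon}c_{22}^{-\varepsilon}};$$ 2) conjugations by $c_{21}^{\varepsilon}$: $$a_{31}^{c_{21}^{\varepsilon}}=a_{31},\quad a_{22}^{c_{21}^{\varepsilon}}=a_{22}^{c_{22}^{\varepsilon}c_{31}^{-\varepsilon}},\quad a_{13}^{c_{21}^{\varepsilon}}=a_{13}^{c_{22}^{\varepsilon}c_{31}^{-\varepsilon}},\quad b_{31}^{c_{21}^{\varepsilon}}=b_{31},\quad b_{22}^{c_{21}^{\varepsilon}}=b_{22}^{c_{22}^{\varepsilon}c_{31}^{-\varepsilon}},\quad b_{13}^{c_{21}^{\varepsilon}}=b_{13}^{c_{22}^{\varepsilon}c_{31}^{-\varepsilon}};$$ 3) conjugations by $c_{12}^{\varepsilon}$: $$a_{31}^{c_{12}^{\varepsilon}}=a_{31},\quad a_{13}^{c_{12}^{\varepsilon}}=a_{13}^{c_{13}^{\varepsilon}c_{31}^{-\varepsilon}},\quad b_{31}^{c_{12}^{\varepsilon}}=b_{31},\quad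 b_{13}^{c_{12}^{\varepsilon}}=b_{13}^{c_{13}^{\varepsilon}c_{31}^{-\varepsilon}},$$ $$a_{22}^{c_{12}^{-1}}=a_{13}^{c_{13}^{-1}c_{31}}a_{13}^{-c_{13}^{-1}c_{22}}a_{22}[c_{21},c_{12}^{-1}],\quad a_{22}^{c_{12}}=[c_{12},c_{21}^{-1}]a_{13}^{-c_{13}c_{22}^{-1}}a_{22}a_{13}^{c_{13}c_{31}^{-1}},$$ $$b_{22}^{c_{12}^{-1}}=b_{13}^{c_{13}^{-1}c_{31}}b_{22}b_{13}^{-c_{13}^{-1}c_{22}}[c_{21},c_{12}^{-1}],\quad b_{22}^{c_{12}}=[c_{12},c_{21}^{-1}]b_{22}b_{13}^{-c_{13}c_{22}^{-1}}b_{13}^{c_{13}c_{31}^{-1}};$$ 4) commutativity relations: $$[a_{21},a_{12}]=[a_{31},a_{22}]=[a_{31},a_{13}]=[a_{22},a_{13}]=1,$$ $$[c_{21}a_{21}^{-1},c_{12}a_{12}^{-1}]=[b_{31},b_{22}]=[b_{31},b_{13}]=[b_{22},b_{13}]=1.$$ -/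

import Mathlib

namespace VirtualBraid

/-- Conjugation `x ^ y = y⁻¹ x y`. -/
def cj {G : Type*} [Group G] (x y : G) : G := y⁻¹ * x * y

/-- The commutator `[x, y] = x⁻¹ y⁻¹ x y`. -/
def cm {G : Type*} [Group G] (x y : G) : G := x⁻¹ * y⁻¹ * x * y

/-! ### Virtual braid groups

Strands are numbered `0, …, n - 1`, and `sigma i`, `rho i` involve the strands `i` and `i + 1`. -/

/-- Generators of the virtual braid group on `n` strands. -/
inductive VBGen (n : ℕ) : Type
  | sigma (i : Fin (n - 1)) : VBGen n
  | rho (i : Fin (n - 1)) : VBGen n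

/-- The letter `σ_i` as a word. -/
def sg {n : ℕ} (i : Fin (n - 1)) : FreeGroup (VBGen n) := FreeGroup.of (VBGen.sigma i)

/-- The letter `ρ_i` as a word. -/
def rh {n : ℕ} (i : Fin (n - 1)) : FreeGroup (VBGen n) := FreeGroup.of (VBGen.rho i)

/-- Defining relations `u = v` of the virtual braid group; `i.val + 1 < j.val` stands for
`|i - j| > 1` up to exchanging the roles of `i` and `j`. -/
inductive VBRel (n : ℕ) : FreeGroup (VBGen n) → FreeGroup (VBGen n) → Prop
  | braid (i j : Fin (n - 1)) (h : i.val + 1 = j.val) :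
      VBRel n (sg i * sg j * sg i) (sg j * sg i * sg j)
  | sigma_comm (i j : Fin (n - 1)) (h : i.val + 1 < j.val) :
      VBRel n (sg i * sg j) (sg j * sg i)
  | rho_sq (i : Fin (n - 1)) : VBRel n (rh i * rh i) 1
  | rho_braid (i j : Fin (n - 1)) (h : i.val + 1 = j.val) :
      VBRel n (rh i * rh j * rh i) (rh j * rh i * rh j)
  | rho_comm (i j : Fin (n - 1)) (h : i.val + 1 < j.val) :
      VBRel n (rh i * rh j) (rh j * rh i)
  | mixed_comm (i j : Fin (n - 1)) (h : i.val + 1 < j.val ∨ j.val + 1 < i.val) :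
      VBRel n (sg i * rh j) (rh j * sg i)
  | mixed_braid (i j : Fin (n - 1)) (h : i.val + 1 = j.val) :
      VBRel n (rh i * rh j * sg i) (sg j * rh i * rh j)

/-- The relators of the virtual braid group. -/
def VBRels (n : ℕ) : Set (FreeGroup (VBGen n)) := {r | ∃ u v, VBRel n u v ∧ r = u * v⁻¹}

/-- The virtual braid group `VB_n`. -/
abbrev VB (n : ℕ) : Type := PresentedGroup (VBRels n)

/-- The element `σ_i` of `VB_n`. -/
def sigma {n : ℕ} (i : Fin (n - 1)) : VB n := PresentedGroup.of (VBGen.sigma i)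

/-- The element `ρ_i` of `VB_n`. -/
def rho {n : ℕ} (i : Fin (n - 1)) : VB n := PresentedGroup.of (VBGen.rho i)

/-- The transposition `(i, i + 1)` of the strands. -/
def transp {n : ℕ} (i : Fin (n - 1)) : Equiv.Perm (Fin n) :=
  Equiv.swap ⟨i.val, by omega⟩ ⟨i.val + 1, by omega⟩

/-- Both `σ_i` and `ρ_i` induce the transposition `(i, i + 1)`. -/
def genPerm {n : ℕ} : VBGen n → Equiv.Perm (Fin n)
  | VBGen.sigma i => transp i
  | VBGen.rho i => transp i

theorem transp_braid {n : ℕ} (i j : Fin (n - 1)) (h : i.val + 1 = j.val) :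
    (transp i * transp j * transp i : Equiv.Perm (Fin n)) = transp j * transp i * transp j := by
  obtain ⟨i, hi⟩ := i
  obtain ⟨j, hj⟩ := j
  simp only at h
  subst h
  have e1 : (⟨i, by omega⟩ : Fin n) ≠ ⟨i + 1, by omega⟩ := by simp
  have e2 : (⟨i, by omega⟩ : Fin n) ≠ ⟨i + 1 + 1, by omega⟩ := by simp [Fin.ext_iff]; omega
  have e3 : (⟨i + 1, by omega⟩ : Fin n) ≠ ⟨i + 1 + 1, by omega⟩ := by simp
  simp only [transp]
  refine Eq.trans ?_ (Equiv.swap_mul_swap_mul_swap e1 e2).symm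
  have := Equiv.swap_mul_swap_mul_swap e3.symm e2.symm
  rwa [Equiv.swap_comm (⟨i + 1, by omega⟩ : Fin n) ⟨i, by omega⟩,
    Equiv.swap_comm (⟨i + 1 + 1, by omega⟩ : Fin n) ⟨i + 1, by omega⟩,
    Equiv.swap_comm (⟨i, by omega⟩ : Fin n) ⟨i + 1 + 1, by omega⟩] at this

theorem transp_comm {n : ℕ} (i j : Fin (n - 1)) (h : i.val + 1 < j.val) :
    (transp i * transp j : Equiv.Perm (Fin n)) = transp j * transp i := by
  apply Equiv.Perm.Disjoint.commute
  apply Equiv.Perm.disjoint_swap_swap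
  simp [Fin.ext_iff]
  omega

theorem lift_genPerm_eq_one {n : ℕ} (r : FreeGroup (VBGen n)) (hr : r ∈ VBRels n) :
    FreeGroup.lift (genPerm (n := n)) r = 1 := by
  obtain ⟨u, v, h, rfl⟩ := hr
  rw [map_mul, map_inv, mul_inv_eq_one]
  cases h with
  | braid i j h => simpa [sg, genPerm] using transp_braid i j h
  | sigma_comm i j h => simpa [sg, genPerm] using transp_comm i j h
  | rho_sq i => simp [rh, genPerm, transp]
  | rho_braid i j h => simpa [rh, genPerm] using transp_braid i j h
  | rho_comm i j h => simpa [rh, genPerm] using transp_comm i j h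
  | mixed_comm i j h =>
    rcases h with h | h
    · simpa [sg, rh, genPerm] using transp_comm i j h
    · simpa [sg, rh, genPerm] using (transp_comm j i h).symm
  | mixed_braid i j h => simpa [sg, rh, genPerm] using transp_braid i j h

/-- The epimorphism `VB_n → S_n` that sends `σ_i` and `ρ_i` to the transposition `(i, i + 1)`. -/
def toPerm (n : ℕ) : VB n →* Equiv.Perm (Fin n) :=
  PresentedGroup.toGroup (f := genPerm) lift_genPerm_eq_one

/-- The virtual pure braid group `VP_n`, the kernel of `VB_n → S_n`. -/
def VP (n : ℕ) : Subgroup (VB n) := (toPerm n).ker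

/-- `ρ_{i+d} ⋯ ρ_{i+1} x ρ_{i+1} ⋯ ρ_{i+d}`. -/
def spread {n : ℕ} (x : VB n) (i : ℕ) : (d : ℕ) → i + d + 1 < n → VB n
  | 0, _ => x
  | d + 1, h => rho ⟨i + d + 1, by omega⟩ * spread x i d (by omega) * rho ⟨i + d + 1, by omega⟩

/-- The element `λ_{ij}` of `VB_n` for `i ≠ j`: `λ_{i,i+1} = ρ_i σ_i⁻¹`, `λ_{i+1,i} = σ_i⁻¹ ρ_i`, and
for `i + 1 < j` one conjugates `λ_{i,i+1}` and `λ_{i+1,i}` by `ρ_{i+1}`, …, `ρ_{j-1}` to get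
`λ_{ij}` and `λ_{ji}`. (The value at `i = j` is irrelevant.) -/
def lamVB {n : ℕ} (i j : Fin n) : VB n :=
  if h : i < j then
    spread (rho ⟨i.val, by omega⟩ * (sigma ⟨i.val, by omega⟩)⁻¹) i.val (j.val - i.val - 1) (by omega)
  else if h' : j < i then
    spread ((sigma ⟨j.val, by omega⟩)⁻¹ * rho ⟨j.val, by omega⟩) j.val (i.val - j.val - 1) (by omega)
  else 1

theorem toPerm_sigma {n : ℕ} (i : Fin (n - 1)) : toPerm n (sigma i) = transp i :=
  PresentedGroup.toGroup.of lift_genPerm_eq_one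

theorem toPerm_rho {n : ℕ} (i : Fin (n - 1)) : toPerm n (rho i) = transp i :=
  PresentedGroup.toGroup.of lift_genPerm_eq_one

theorem transp_mul_self {n : ℕ} (i : Fin (n - 1)) :
    (transp i * transp i : Equiv.Perm (Fin n)) = 1 := by
  simp [transp]

theorem spread_mem {n : ℕ} (x : VB n) (hx : x ∈ VP n) (i d : ℕ) (h : i + d + 1 < n) :
    spread x i d h ∈ VP n := by
  induction d with
  | zero => exact hx
  | succ d ih =>
    have := ih (by omega)
    simp only [VP, MonoidHom.mem_ker] at this ⊢
    simp [spread, this, toPerm_rho, transp_mul_self]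

theorem lamVB_mem {n : ℕ} (i j : Fin n) : lamVB i j ∈ VP n := by
  unfold lamVB
  split_ifs
  · apply spread_mem
    simp [VP, MonoidHom.mem_ker, toPerm_rho, toPerm_sigma]
  · apply spread_mem
    simp [VP, MonoidHom.mem_ker, toPerm_rho, toPerm_sigma]
  · exact one_mem _

/-- The element `λ_{ij}` of `VP_n`, strands numbered from `0`. -/
def lam {n : ℕ} (i j : Fin n) : VP n := ⟨lamVB i j, lamVB_mem i j⟩

/-! ### The cabled elements of `VP_4`

From here on the strands are numbered `1, 2, 3, 4`. -/

/-- `λ_{12}` -/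
def l12 : VP 4 := lam 0 1
/-- `λ_{13}` -/
def l13 : VP 4 := lam 0 2
/-- `λ_{14}` -/
def l14 : VP 4 := lam 0 3
/-- `λ_{21}` -/
def l21 : VP 4 := lam 1 0
/-- `λ_{23}` -/
def l23 : VP 4 := lam 1 2
/-- `λ_{24}` -/
def l24 : VP 4 := lam 1 3
/-- `λ_{31}` -/
def l31 : VP 4 := lam 2 0
/-- `λ_{32}` -/
def l32 : VP 4 := lam 2 1
/-- `λ_{34}` -/
def l34 : VP 4 := lam 2 3
/-- `λ_{41}` -/
def l41 : VP 4 := lam 3 0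
/-- `λ_{42}` -/
def l42 : VP 4 := lam 3 1
/-- `λ_{43}` -/
def l43 : VP 4 := lam 3 2

def a11 : VP 4 := l12
def b11 : VP 4 := l21
def a21 : VP 4 := l13 * l23
def a12 : VP 4 := l13 * a11
def b21 : VP 4 := l32 * l31
def b12 : VP 4 := b11 * l31
def a31 : VP 4 := l14 * l24 * l34
def a22 : VP 4 := l14 * l24 * a21
def a13 : VP 4 := l14 * a12
def b31 : VP 4 := l43 * l42 * l41
def b22 : VP 4 := b21 * l42 * l41
def b13 : VP 4 := b12 * l41
def c11 : VP 4 := b11 * a11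
def c21 : VP 4 := b21 * a21
def c12 : VP 4 := b12 * a12

/-! ### The base group and the associated subgroups -/

/-- Names of the eleven generators of the base group. -/
inductive Gen : Type
  | c11 | a21 | a12 | c21 | c12 | a31 | a22 | a13 | b31 | b22 | b13

/-- The generators of the base group as elements of `VP_4`. -/
def genVal : Gen → VP 4
  | .c11 => c11
  | .a21 => a21
  | .a12 => a12
  | .c21 => c21
  | .c12 => c12
  | .a31 => a31
  | .a22 => a22
  | .a13 => a13
  | .b31 => b31
  | .b22 => b22
  | .b13 => b13

/-- The base group `G_4`. -/
def G4 : Subgroup (VP 4) := Subgroup.closure (Set.range genVal)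

/-- The associated subgroup `A = ⟨λ_{34}, λ_{24}, λ_{14}, λ_{43}, λ_{42}, λ_{41}⟩`. -/
def A : Subgroup (VP 4) := Subgroup.closure {l34, l24, l14, l43, l42, l41}

/-- The associated subgroup `B = A ^ a₁₁ = a₁₁⁻¹ A a₁₁`. -/
def B : Subgroup (VP 4) := A.map (MulAut.conj a11⁻¹).toMonoidHom

/-- The subgroup generated by six words in the generators of the base group, where
`b₂₁ = c₂₁ a₂₁⁻¹` and `b₁₂ = c₁₂ a₁₂⁻¹`. -/
def BWords : Subgroup (VP 4) := Subgroup.closure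
  {a21 * a22⁻¹ * a31,
   cj (a12 * a13⁻¹ * a22 * a21⁻¹) a12,
   cj (a13 * a12⁻¹) (a21⁻¹ * a12),
   b31 * b22⁻¹ * b21,
   cj (b21⁻¹ * b22 * b13⁻¹ * b12) a12,
   cj (b12⁻¹ * b13) (a21⁻¹ * a12)}

/-! ### The relations of the base group

Words in the eleven generators; a pair `(u, v)` stands for the relation `u = v`. -/

namespace W

def c11 : FreeGroup Gen := FreeGroup.of .c11
def a21 : FreeGroup Gen := FreeGroup.of .a21
def a12 : FreeGroup Gen := FreeGroup.of .a12
def c21 : FreeGroup Gen := FreeGroup.of .c21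
def c12 : FreeGroup Gen := FreeGroup.of .c12
def a31 : FreeGroup Gen := FreeGroup.of .a31
def a22 : FreeGroup Gen := FreeGroup.of .a22
def a13 : FreeGroup Gen := FreeGroup.of .a13
def b31 : FreeGroup Gen := FreeGroup.of .b31
def b22 : FreeGroup Gen := FreeGroup.of .b22
def b13 : FreeGroup Gen := FreeGroup.of .b13

/-- `c_{ij} = b_{ij} a_{ij}` for `i + j = 4`. -/
def c31 : FreeGroup Gen := b31 * a31
def c22 : FreeGroup Gen := b22 * a22
def c13 : FreeGroup Gen := b13 * a13

/-- Conjugations by `c₁₁ ^ ε`. -/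
def conjC11 (ε : ℤ) : List (FreeGroup Gen × FreeGroup Gen) :=
  [(cj a21 (c11 ^ ε), a21),
   (cj a12 (c11 ^ ε), cj a12 (c12 ^ ε * c21 ^ (-ε))),
   (cj c21 (c11 ^ ε), c21),
   (cj c12 (c11 ^ ε), cj c12 (c21 ^ (-ε))),
   (cj a31 (c11 ^ ε), a31),
   (cj a22 (c11 ^ ε), a22),
   (cj a13 (c11 ^ ε), cj a13 (c13 ^ ε * c22 ^ (-ε))),
   (cj b31 (c11 ^ ε), b31),
   (cj b22 (c11 ^ ε), b22),
   (cj b13 (c11 ^ ε), cj b13 (c13 ^ ε * c22 ^ (-ε)))]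

/-- Conjugations by `c₂₁ ^ ε`. -/
def conjC21 (ε : ℤ) : List (FreeGroup Gen × FreeGroup Gen) :=
  [(cj a31 (c21 ^ ε), a31),
   (cj a22 (c21 ^ ε), cj a22 (c22 ^ ε * c31 ^ (-ε))),
   (cj a13 (c21 ^ ε), cj a13 (c22 ^ ε * c31 ^ (-ε))),
   (cj b31 (c21 ^ ε), b31),
   (cj b22 (c21 ^ ε), cj b22 (c22 ^ ε * c31 ^ (-ε))),
   (cj b13 (c21 ^ ε), cj b13 (c22 ^ ε * c31 ^ (-ε)))]

/-- Conjugations of `a₃₁`, `a₁₃`, `b₃₁`, `b₁₃` by `c₁₂ ^ ε`. -/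
def conjC12 (ε : ℤ) : List (FreeGroup Gen × FreeGroup Gen) :=
  [(cj a31 (c12 ^ ε), a31),
   (cj a13 (c12 ^ ε), cj a13 (c13 ^ ε * c31 ^ (-ε))),
   (cj b31 (c12 ^ ε), b31),
   (cj b13 (c12 ^ ε), cj b13 (c13 ^ ε * c31 ^ (-ε)))]

/-- Conjugations of `a₂₂` and `b₂₂` by `c₁₂⁻¹` and `c₁₂`. -/
def conjC12' : List (FreeGroup Gen × FreeGroup Gen) :=
  [(cj a22 c12⁻¹,
      cj a13 (c13⁻¹ * c31) * cj a13⁻¹ (c13⁻¹ * c22) * a22 * cm c21 c12⁻¹),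
   (cj a22 c12,
      cm c12 c21⁻¹ * cj a13⁻¹ (c13 * c22⁻¹) * a22 * cj a13 (c13 * c31⁻¹)),
   (cj b22 c12⁻¹,
      cj b13 (c13⁻¹ * c31) * b22 * cj b13⁻¹ (c13⁻¹ * c22) * cm c21 c12⁻¹),
   (cj b22 c12,
      cm c12 c21⁻¹ * b22 * cj b13⁻¹ (c13 * c22⁻¹) * cj b13 (c13 * c31⁻¹))]

/-- Commutativity relations. -/
def commut : List (FreeGroup Gen × FreeGroup Gen) :=
  [(cm a21 a12, 1), (cm a31 a22, 1), (cm a31 a13, 1), (cm a22 a13, 1),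
   (cm (c21 * a21⁻¹) (c12 * a12⁻¹), 1), (cm b31 b22, 1), (cm b31 b13, 1), (cm b22 b13, 1)]

end W

/-- The relators of the base group. -/
def G4Rels : Set (FreeGroup Gen) :=
  {r | ∃ u v : FreeGroup Gen, r = u * v⁻¹ ∧
    ((∃ ε : ℤ, (ε = 1 ∨ ε = -1) ∧ (u, v) ∈ W.conjC11 ε ++ W.conjC21 ε ++ W.conjC12 ε) ∨
      (u, v) ∈ W.conjC12' ++ W.commut)}

end VirtualBraid

/-! The plan is to identify `VP_4` with an abstract HNN-extension by comparing presentations, and to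
let the embedding of the base into an HNN-extension prove that the listed relations define the base
group.

The comparison rests on a presentation of `VP_4`: the generators are the `λ_{ij}`, with the
Yang–Baxter relation for every ordered triple of strands and commutation for disjoint pairs. It
comes from the splitting of `VB_4` as a semidirect product of the presented group by `S_4`
(`lift_lam_bijective`). On three strands the six Yang–Baxter relations amount to six commutations
between cabled elements (`triple_iff_cabled`). Doubling a strand produces the four-strand relations,
provided the disjoint pairs commute (`isYB_iff_cabledRel`). The long list of relations of the base
group reduces to such commutations and two exchange identities (`lift_rels_iff_baseRel`). Adding the
six relations of the stable letter gives the relations of `VP_4`, and conversely (`BaseRel.isYB`,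
`IsYB.baseRel`, `IsYB.aWord_mul`).

To form an HNN-extension over the presented base one needs isomorphic associated subgroups. They are
free: a representation of `VP_4` in the holomorph of a free group sends the six generators of `A` to
distinct free generators (`lift_lam_injective`). So the six words for `A` and the six for `B` are
free bases already in the presented group. The comparison `exists_hnn_equiv` then applies twice.
Over the presented group it shows that this group embeds in `VP_4`, with image `G4`. Over `G4`
itself it gives the decomposition of the theorem. -/

namespace VirtualBraid

/-! ### Yang–Baxter relations and cabled generators -/

section Algebra

variable {G : Type*} [Group G]

/-- The Yang–Baxter equation `x y z = z y x`. -/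
def YBE (x y z : G) : Prop := x * y * z = z * y * x

theorem YBE.symm {x y z : G} (h : YBE x y z) : YBE z y x := Eq.symm h

/-- The commutations separate primed from unprimed letters, and the known equation for `u, v, w`
then makes `u * v` a common left factor of both sides. The two variants below cancel in the same way
on the right, or on both ends. Together they cover every position of a doubled strand. -/
theorem ybe_mul_left_iff {u u' v v' w : G} (h₁ : Commute u' v) (h₂ : Commute v' u)
    (h : YBE u v w) : YBE (u * u') (v * v') w ↔ YBE u' v' w := by
  unfold YBE at *
  have e₁ : u * u' * (v * v') * w = u * v * (u' * v' * w) := by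
    calc _ = u * (u' * v) * v' * w := by group
      _ = _ := by rw [h₁.eq]; group
  have e₂ : w * (v * v') * (u * u') = u * v * (w * v' * u') := by
    calc _ = w * v * (v' * u) * u' := by group
      _ = w * v * u * v' * u' := by rw [h₂.eq]; group
      _ = _ := by rw [← h]; group
  rw [e₁, e₂, mul_right_inj]

theorem ybe_mul_left_iff' {u u' v v' w : G} (h₁ : Commute u' v) (h₂ : Commute v' u)
    (h : YBE u' v' w) : YBE (u * u') (v * v') w ↔ YBE u v w := by
  unfold YBE at *
  have e₁ : u * u' * (v * v') * w = u * v * w * (v' * u') := by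
    calc _ = u * (u' * v) * v' * w := by group
      _ = u * v * (u' * v' * w) := by rw [h₁.eq]; group
      _ = _ := by rw [h]; group
  have e₂ : w * (v * v') * (u * u') = w * v * u * (v' * u') := by
    calc _ = w * v * (v' * u) * u' := by group
      _ = _ := by rw [h₂.eq]; group
  rw [e₁, e₂, mul_left_inj]

theorem ybe_mul_mul_iff {u u' v w w' : G} (h₁ : Commute u w) (h₂ : Commute u' w')
    (h : YBE u' v w) : YBE (u * u') v (w * w') ↔ YBE u v w' := by
  unfold YBE at *
  have e₁ : u * u' * v * (w * w') = w * (u * v * w') * u' := by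
    calc _ = u * (u' * v * w) * w' := by group
      _ = (u * w) * v * (u' * w') := by rw [h]; group
      _ = _ := by rw [h₁.eq, h₂.eq]; group
  have e₂ : w * w' * v * (u * u') = w * (w' * v * u) * u' := by group
  rw [e₁, e₂, mul_left_inj, mul_right_inj]

/-- The relations of the virtual pure braid group on three strands. -/
structure Triple (x₁₂ x₂₁ x₁₃ x₃₁ x₂₃ x₃₂ : G) : Prop where
  h₁₂₃ : YBE x₁₂ x₁₃ x₂₃
  h₃₂₁ : YBE x₃₂ x₃₁ x₂₁
  h₂₁₃ : YBE x₂₁ x₂₃ x₁₃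
  h₃₁₂ : YBE x₃₁ x₃₂ x₁₂
  h₁₃₂ : YBE x₁₃ x₁₂ x₃₂
  h₂₃₁ : YBE x₂₃ x₂₁ x₃₁

/-- The relations of the virtual pure braid group on three strands in cabled generators. -/
structure Cabled (c a b a' b' : G) : Prop where
  comm_a : Commute a a'
  comm_b : Commute b b'
  comm_ca : Commute c a
  comm_cb : Commute c b
  comm_a' : Commute (c * (b * a) * (b' * a')⁻¹) a'
  comm_b' : Commute (c * (b * a) * (b' * a')⁻¹) b'

/-- Only two of the six relations are used, so this is available before the last two are known. Once
`x₃₂ * x₂₃` commutes with `x₂₁ * x₃₁` the conjugation disappears, which is `Triple.cabled_eq`. -/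
theorem cabled_conj_eq {x₁₂ x₂₁ x₁₃ x₃₁ x₂₃ x₃₂ : G} (h₁ : YBE x₁₂ x₁₃ x₂₃)
    (h₄ : YBE x₃₁ x₃₂ x₁₂) :
    x₂₁ * x₁₂ * (x₃₂ * x₃₁ * (x₁₃ * x₂₃)) * (x₂₁ * x₃₁ * (x₁₃ * x₁₂))⁻¹ =
      (x₂₁ * x₃₁) * (x₃₂ * x₂₃) * (x₂₁ * x₃₁)⁻¹ := by
  rw [mul_inv_eq_iff_eq_mul]
  unfold YBE at h₁ h₄
  calc _ = x₂₁ * (x₁₂ * x₃₂ * x₃₁) * x₁₃ * x₂₃ := by group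
    _ = x₂₁ * x₃₁ * x₃₂ * (x₁₂ * x₁₃ * x₂₃) := by rw [← h₄]; group
    _ = _ := by rw [h₁]; group

theorem commute_iff_ybe {x₂₁ x₃₁ x₂₃ x₃₂ : G} (h₂ : YBE x₃₂ x₃₁ x₂₁) :
    Commute (x₃₂ * x₂₃) (x₂₁ * x₃₁) ↔ YBE x₂₃ x₂₁ x₃₁ := by
  unfold YBE Commute SemiconjBy at *
  have e₁ : x₂₁ * x₃₁ * (x₃₂ * x₂₃) = x₃₂ * (x₃₁ * x₂₁ * x₂₃) := by
    rw [← mul_assoc, ← h₂]; group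
  have e₂ : x₃₂ * x₂₃ * (x₂₁ * x₃₁) = x₃₂ * (x₂₃ * x₂₁ * x₃₁) := by group
  rw [e₁, e₂, mul_right_inj]

theorem Triple.cabled_eq {x₁₂ x₂₁ x₁₃ x₃₁ x₂₃ x₃₂ : G} (h : Triple x₁₂ x₂₁ x₁₃ x₃₁ x₂₃ x₃₂) :
    x₂₁ * x₁₂ * (x₃₂ * x₃₁ * (x₁₃ * x₂₃)) * (x₂₁ * x₃₁ * (x₁₃ * x₁₂))⁻¹ = x₃₂ * x₂₃ := by
  rw [cabled_conj_eq h.h₁₂₃ h.h₃₁₂, ← ((commute_iff_ybe h.h₃₂₁).2 h.h₂₃₁).eq, mul_inv_cancel_right]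

/-- Each Yang–Baxter relation corresponds to one commutation, but some equivalences need relations
obtained earlier: `k₁` and `k₂` are unconditional, and the others build on them. The element in
`comm_a'` and `comm_b'` is `x₃₂ * x₂₃` in disguise. -/
theorem triple_iff_cabled {x₁₂ x₂₁ x₁₃ x₃₁ x₂₃ x₃₂ : G} :
    Triple x₁₂ x₂₁ x₁₃ x₃₁ x₂₃ x₃₂ ↔
      Cabled (x₂₁ * x₁₂) (x₁₃ * x₂₃) (x₃₂ * x₃₁) (x₁₃ * x₁₂) (x₂₁ * x₃₁) := by
  have k₁ : YBE x₁₂ x₁₃ x₂₃ ↔ Commute (x₁₃ * x₂₃) (x₁₃ * x₁₂) := by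
    unfold YBE Commute SemiconjBy
    rw [← mul_right_inj x₁₃]
    simp only [mul_assoc]
    exact eq_comm
  have k₂ : YBE x₃₂ x₃₁ x₂₁ ↔ Commute (x₃₂ * x₃₁) (x₂₁ * x₃₁) := by
    unfold YBE Commute SemiconjBy
    rw [← mul_left_inj x₃₁]
    simp only [mul_assoc]
  have k₃ (h : YBE x₁₂ x₁₃ x₂₃) : YBE x₂₁ x₂₃ x₁₃ ↔ Commute (x₂₁ * x₁₂) (x₁₃ * x₂₃) := by
    unfold YBE Commute SemiconjBy at *
    have e₁ : x₂₁ * x₁₂ * (x₁₃ * x₂₃) = x₂₁ * x₂₃ * x₁₃ * x₁₂ := by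
      calc _ = x₂₁ * (x₁₂ * x₁₃ * x₂₃) := by group
        _ = _ := by rw [h]; group
    rw [e₁, ← mul_left_inj x₁₂]
    simp only [mul_assoc]
  have k₄ (h : YBE x₃₂ x₃₁ x₂₁) : YBE x₃₁ x₃₂ x₁₂ ↔ Commute (x₂₁ * x₁₂) (x₃₂ * x₃₁) := by
    unfold YBE Commute SemiconjBy at *
    have e₁ : x₃₂ * x₃₁ * (x₂₁ * x₁₂) = x₂₁ * (x₃₁ * x₃₂ * x₁₂) := by
      calc _ = (x₃₂ * x₃₁ * x₂₁) * x₁₂ := by group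
        _ = _ := by rw [h]; group
    rw [e₁, ← mul_right_inj x₂₁, eq_comm]
    simp only [mul_assoc]
  have k₆ (h₁ : YBE x₁₂ x₁₃ x₂₃) : Commute (x₃₂ * x₂₃) (x₁₃ * x₁₂) ↔ YBE x₁₃ x₁₂ x₃₂ := by
    unfold YBE Commute SemiconjBy at *
    have e₁ : x₃₂ * x₂₃ * (x₁₃ * x₁₂) = x₃₂ * x₁₂ * x₁₃ * x₂₃ := by
      calc _ = x₃₂ * (x₂₃ * x₁₃ * x₁₂) := by group
        _ = _ := by rw [← h₁]; group
    rw [e₁, ← mul_assoc, mul_left_inj, eq_comm]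
  have conj_iff : Commute ((x₂₁ * x₃₁) * (x₃₂ * x₂₃) * (x₂₁ * x₃₁)⁻¹) (x₂₁ * x₃₁) ↔
      Commute (x₃₂ * x₂₃) (x₂₁ * x₃₁) := by
    have := Commute.conj_iff (a := x₃₂ * x₂₃) (b := x₂₁ * x₃₁) (x₂₁ * x₃₁)
    rwa [mul_inv_cancel_right (x₂₁ * x₃₁) (x₂₁ * x₃₁)] at this
  constructor
  · intro h
    have hk := h.cabled_eq
    exact ⟨k₁.1 h.h₁₂₃, k₂.1 h.h₃₂₁, (k₃ h.h₁₂₃).1 h.h₂₁₃, (k₄ h.h₃₂₁).1 h.h₃₁₂,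
      hk ▸ (k₆ h.h₁₂₃).2 h.h₁₃₂, hk ▸ (commute_iff_ybe h.h₃₂₁).2 h.h₂₃₁⟩
  · intro h
    have h₁ := k₁.2 h.comm_a
    have h₂ := k₂.2 h.comm_b
    have h₄ := (k₄ h₂).2 h.comm_cb
    have hk := cabled_conj_eq (x₂₁ := x₂₁) h₁ h₄
    -- So far the element is only known to be the conjugate of `x₃₂ * x₂₃` by `x₂₁ * x₃₁`. Commuting
    -- with the conjugating element is unaffected by that conjugation, which then cancels.
    have hc := conj_iff.1 (hk ▸ h.comm_b')
    rw [← hc.eq, mul_inv_cancel_right] at hk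
    exact ⟨h₁, h₂, (k₃ h₁).2 h.comm_ca, h₄, (k₆ h₁).1 (hk ▸ h.comm_a'), (commute_iff_ybe h₂).1 hc⟩

/-- A solution of the Yang–Baxter relations indexed by ordered pairs: the relations of the virtual
pure braid group. -/
structure IsYB {n : ℕ} (l : Fin n → Fin n → G) : Prop where
  diag : ∀ i, l i i = 1
  comm : ∀ i j k m, i ≠ j → i ≠ k → i ≠ m → j ≠ k → j ≠ m → k ≠ m → Commute (l i j) (l k m)
  yb : ∀ k i j, k ≠ i → k ≠ j → i ≠ j → YBE (l k i) (l k j) (l i j)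

theorem IsYB.map {n : ℕ} {l : Fin n → Fin n → G} (h : IsYB l) {H : Type*} [Group H] (f : G →* H) :
    IsYB fun i j => f (l i j) where
  diag i := by simp [h.diag]
  comm i j k m h₁ h₂ h₃ h₄ h₅ h₆ := (h.comm i j k m h₁ h₂ h₃ h₄ h₅ h₆).map f
  yb k i j h₁ h₂ h₃ := by
    have := congrArg f (h.yb k i j h₁ h₂ h₃)
    simpa [YBE] using this

theorem IsYB.triple {n : ℕ} {l : Fin n → Fin n → G} (h : IsYB l) (i j k : Fin n) (hij : i ≠ j)
    (hik : i ≠ k) (hjk : j ≠ k) : Triple (l i j) (l j i) (l i k) (l k i) (l j k) (l k j) where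
  h₁₂₃ := h.yb i j k hij hik hjk
  h₃₂₁ := h.yb k j i hjk.symm hik.symm hij.symm
  h₂₁₃ := h.yb j i k hij.symm hjk hik
  h₃₁₂ := h.yb k i j hik.symm hjk.symm hij
  h₁₃₂ := h.yb i k j hik hij hjk.symm
  h₂₃₁ := h.yb j k i hjk hij.symm hik.symm

/-- The commutation relations of the virtual pure braid group on four strands. -/
structure DisjointComm (l : Fin 4 → Fin 4 → G) : Prop where
  c₁₂₃₄ : Commute (l 0 1) (l 2 3)
  c₁₂₄₃ : Commute (l 0 1) (l 3 2)
  c₂₁₃₄ : Commute (l 1 0) (l 2 3)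
  c₂₁₄₃ : Commute (l 1 0) (l 3 2)
  c₁₃₂₄ : Commute (l 0 2) (l 1 3)
  c₁₃₄₂ : Commute (l 0 2) (l 3 1)
  c₃₁₂₄ : Commute (l 2 0) (l 1 3)
  c₃₁₄₂ : Commute (l 2 0) (l 3 1)
  c₂₃₁₄ : Commute (l 1 2) (l 0 3)
  c₂₃₄₁ : Commute (l 1 2) (l 3 0)
  c₃₂₁₄ : Commute (l 2 1) (l 0 3)
  c₃₂₄₁ : Commute (l 2 1) (l 3 0)

theorem IsYB.disjointComm {l : Fin 4 → Fin 4 → G} (h : IsYB l) : DisjointComm l := by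
  constructor <;> apply h.comm <;> decide

theorem isYB_four {l : Fin 4 → Fin 4 → G} (hd : ∀ i, l i i = 1) (hc : DisjointComm l)
    (h₁ : Triple (l 0 1) (l 1 0) (l 0 2) (l 2 0) (l 1 2) (l 2 1))
    (h₂ : Triple (l 0 1) (l 1 0) (l 0 3) (l 3 0) (l 1 3) (l 3 1))
    (h₃ : Triple (l 0 2) (l 2 0) (l 0 3) (l 3 0) (l 2 3) (l 3 2))
    (h₄ : Triple (l 1 2) (l 2 1) (l 1 3) (l 3 1) (l 2 3) (l 3 2)) : IsYB l := by
  obtain ⟨a₁, a₂, a₃, a₄, a₅, a₆⟩ := h₁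
  obtain ⟨b₁, b₂, b₃, b₄, b₅, b₆⟩ := h₂
  obtain ⟨d₁, d₂, d₃, d₄, d₅, d₆⟩ := h₃
  obtain ⟨e₁, e₂, e₃, e₄, e₅, e₆⟩ := h₄
  obtain ⟨k₁, k₂, k₃, k₄, k₅, k₆, k₇, k₈, k₉, k₁₀, k₁₁, k₁₂⟩ := hc
  refine ⟨hd, ?_, ?_⟩
  · intro i j k m
    fin_cases i <;> fin_cases j <;> fin_cases k <;> fin_cases m <;> intro h₁ h₂ h₃ h₄ h₅ h₆ <;>
      first
      | exact absurd rfl h₁ | exact absurd rfl h₂ | exact absurd rfl h₃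
      | exact absurd rfl h₄ | exact absurd rfl h₅ | exact absurd rfl h₆
      | assumption
      | (apply Commute.symm; assumption)
  · intro k i j
    fin_cases k <;> fin_cases i <;> fin_cases j <;> intro h₁ h₂ h₃ <;>
      first
      | exact absurd rfl h₁ | exact absurd rfl h₂ | exact absurd rfl h₃
      | assumption

/-! ### Doubling a strand -/

section Doubling

variable {l : Fin 4 → Fin 4 → G}

/-- Strand `3` is replaced by the cable of `3` and `4`. The relations for `1, 2, 3` factor out of
the six cabled equations and leave those for `1, 2, 4`. The next two lemmas double the middle and
the first strand, leading on to `1, 3, 4` and then `2, 3, 4`. -/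
theorem triple_double_last (hc : DisjointComm l)
    (h₁ : Triple (l 0 1) (l 1 0) (l 0 2) (l 2 0) (l 1 2) (l 2 1)) :
    Triple (l 0 1) (l 1 0) (l 0 3 * l 0 2) (l 2 0 * l 3 0) (l 1 3 * l 1 2) (l 2 1 * l 3 1) ↔
      Triple (l 0 1) (l 1 0) (l 0 3) (l 3 0) (l 1 3) (l 3 1) := by
  have e₁ := ybe_mul_left_iff' (u := l 1 3) (u' := l 1 2) (v := l 0 3) (v' := l 0 2) (w := l 0 1)
    hc.c₂₃₁₄ hc.c₁₃₂₄ h₁.h₁₂₃.symm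
  have e₂ := ybe_mul_left_iff (u := l 2 1) (u' := l 3 1) (v := l 2 0) (v' := l 3 0) (w := l 1 0)
    hc.c₃₁₄₂.symm hc.c₃₂₄₁.symm h₁.h₃₂₁
  have e₃ := ybe_mul_left_iff' (u := l 0 3) (u' := l 0 2) (v := l 1 3) (v' := l 1 2) (w := l 1 0)
    hc.c₁₃₂₄ hc.c₂₃₁₄ h₁.h₂₁₃.symm
  have e₄ := ybe_mul_left_iff (u := l 2 0) (u' := l 3 0) (v := l 2 1) (v' := l 3 1) (w := l 0 1)
    hc.c₃₂₄₁.symm hc.c₃₁₄₂.symm h₁.h₃₁₂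
  have e₅ := ybe_mul_mul_iff (u := l 0 3) (u' := l 0 2) (v := l 0 1) (w := l 2 1) (w' := l 3 1)
    hc.c₃₂₁₄.symm hc.c₁₃₄₂ h₁.h₁₃₂
  have e₆ := ybe_mul_mul_iff (u := l 1 3) (u' := l 1 2) (v := l 1 0) (w := l 2 0) (w' := l 3 0)
    hc.c₃₁₂₄.symm hc.c₂₃₄₁ h₁.h₂₃₁
  exact ⟨fun ⟨a₁, a₂, a₃, a₄, a₅, a₆⟩ => ⟨(e₁.1 a₁.symm).symm, e₂.1 a₂, (e₃.1 a₃.symm).symm,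
      e₄.1 a₄, e₅.1 a₅, e₆.1 a₆⟩,
    fun ⟨a₁, a₂, a₃, a₄, a₅, a₆⟩ => ⟨(e₁.2 a₁.symm).symm, e₂.2 a₂, (e₃.2 a₃.symm).symm,
      e₄.2 a₄, e₅.2 a₅, e₆.2 a₆⟩⟩

theorem triple_double_middle (hc : DisjointComm l)
    (h₂ : Triple (l 0 1) (l 1 0) (l 0 3) (l 3 0) (l 1 3) (l 3 1)) :
    Triple (l 0 2 * l 0 1) (l 1 0 * l 2 0) (l 0 3) (l 3 0) (l 1 3 * l 2 3) (l 3 2 * l 3 1) ↔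
      Triple (l 0 2) (l 2 0) (l 0 3) (l 3 0) (l 2 3) (l 3 2) := by
  have e₁ := ybe_mul_mul_iff (u := l 0 2) (u' := l 0 1) (v := l 0 3) (w := l 1 3) (w' := l 2 3)
    hc.c₁₃₂₄ hc.c₁₂₃₄ h₂.h₁₂₃
  have e₂ := ybe_mul_mul_iff (u := l 3 2) (u' := l 3 1) (v := l 3 0) (w := l 1 0) (w' := l 2 0)
    hc.c₂₁₄₃.symm hc.c₃₁₄₂.symm h₂.h₃₂₁
  have e₃ := ybe_mul_left_iff (u := l 1 0) (u' := l 2 0) (v := l 1 3) (v' := l 2 3) (w := l 0 3)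
    hc.c₃₁₂₄ hc.c₂₁₃₄.symm h₂.h₂₁₃
  have e₄ := ybe_mul_left_iff' (u := l 0 2) (u' := l 0 1) (v := l 3 2) (v' := l 3 1) (w := l 3 0)
    hc.c₁₂₄₃ hc.c₁₃₄₂.symm h₂.h₃₁₂.symm
  have e₅ := ybe_mul_left_iff' (u := l 3 2) (u' := l 3 1) (v := l 0 2) (v' := l 0 1) (w := l 0 3)
    hc.c₁₃₄₂.symm hc.c₁₂₄₃ h₂.h₁₃₂.symm
  have e₆ := ybe_mul_left_iff (u := l 1 3) (u' := l 2 3) (v := l 1 0) (v' := l 2 0) (w := l 3 0)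
    hc.c₂₁₃₄.symm hc.c₃₁₂₄ h₂.h₂₃₁
  exact ⟨fun ⟨a₁, a₂, a₃, a₄, a₅, a₆⟩ => ⟨e₁.1 a₁, e₂.1 a₂, e₃.1 a₃, (e₄.1 a₄.symm).symm,
      (e₅.1 a₅.symm).symm, e₆.1 a₆⟩,
    fun ⟨a₁, a₂, a₃, a₄, a₅, a₆⟩ => ⟨e₁.2 a₁, e₂.2 a₂, e₃.2 a₃, (e₄.2 a₄.symm).symm,
      (e₅.2 a₅.symm).symm, e₆.2 a₆⟩⟩

theorem triple_double_first (hc : DisjointComm l)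
    (h₃ : Triple (l 0 2) (l 2 0) (l 0 3) (l 3 0) (l 2 3) (l 3 2)) :
    Triple (l 0 2 * l 1 2) (l 2 1 * l 2 0) (l 0 3 * l 1 3) (l 3 1 * l 3 0) (l 2 3) (l 3 2) ↔
      Triple (l 1 2) (l 2 1) (l 1 3) (l 3 1) (l 2 3) (l 3 2) := by
  have e₁ := ybe_mul_left_iff (u := l 0 2) (u' := l 1 2) (v := l 0 3) (v' := l 1 3) (w := l 2 3)
    hc.c₂₃₁₄ hc.c₁₃₂₄.symm h₃.h₁₂₃
  have e₂ := ybe_mul_left_iff' (u := l 2 1) (u' := l 2 0) (v := l 3 1) (v' := l 3 0) (w := l 3 2)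
    hc.c₃₁₄₂ hc.c₃₂₄₁.symm h₃.h₃₂₁.symm
  have e₃ := ybe_mul_mul_iff (u := l 2 1) (u' := l 2 0) (v := l 2 3) (w := l 0 3) (w' := l 1 3)
    hc.c₃₂₁₄ hc.c₃₁₂₄ h₃.h₂₁₃
  have e₄ := ybe_mul_mul_iff (u := l 3 1) (u' := l 3 0) (v := l 3 2) (w := l 0 2) (w' := l 1 2)
    hc.c₁₃₄₂.symm hc.c₂₃₄₁.symm h₃.h₃₁₂
  have e₅ := ybe_mul_left_iff (u := l 0 3) (u' := l 1 3) (v := l 0 2) (v' := l 1 2) (w := l 3 2)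
    hc.c₁₃₂₄.symm hc.c₂₃₁₄ h₃.h₁₃₂
  have e₆ := ybe_mul_left_iff' (u := l 3 1) (u' := l 3 0) (v := l 2 1) (v' := l 2 0) (w := l 2 3)
    hc.c₃₂₄₁.symm hc.c₃₁₄₂ h₃.h₂₃₁.symm
  exact ⟨fun ⟨a₁, a₂, a₃, a₄, a₅, a₆⟩ => ⟨e₁.1 a₁, (e₂.1 a₂.symm).symm, e₃.1 a₃, e₄.1 a₄,
      e₅.1 a₅, (e₆.1 a₆.symm).symm⟩,
    fun ⟨a₁, a₂, a₃, a₄, a₅, a₆⟩ => ⟨e₁.2 a₁, (e₂.2 a₂.symm).symm, e₃.2 a₃, e₄.2 a₄,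
      e₅.2 a₅, (e₆.2 a₆.symm).symm⟩⟩

end Doubling

/-! ### Base relations, the stable letter and the relations of `VP_4` -/

/-- The element `b₂₁` in terms of the generators of the base group. -/
def genB21 (f : Gen → G) : G := f .c21 * (f .a21)⁻¹

/-- The element `b₁₂` in terms of the generators of the base group. -/
def genB12 (f : Gen → G) : G := f .c12 * (f .a12)⁻¹

/-- The cabled elements of a solution of the Yang–Baxter relations on four strands. -/
def cabledGen (l : Fin 4 → Fin 4 → G) : Gen → G
  | .c11 => l 1 0 * l 0 1
  | .a21 => l 0 2 * l 1 2
  | .a12 => l 0 2 * l 0 1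
  | .c21 => l 2 1 * l 2 0 * (l 0 2 * l 1 2)
  | .c12 => l 1 0 * l 2 0 * (l 0 2 * l 0 1)
  | .a31 => l 0 3 * l 1 3 * l 2 3
  | .a22 => l 0 3 * l 1 3 * (l 0 2 * l 1 2)
  | .a13 => l 0 3 * (l 0 2 * l 0 1)
  | .b31 => l 3 2 * l 3 1 * l 3 0
  | .b22 => l 2 1 * l 2 0 * l 3 1 * l 3 0
  | .b13 => l 1 0 * l 2 0 * l 3 0

/-- The cabled form of the relations of the virtual pure braid groups on the strands `1, 2, 3`,
`1, 2, 34`, `12, 3, 4` and `1, 23, 4`. -/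
structure CabledRel (f : Gen → G) : Prop where
  t₁ : Cabled (f .c11) (f .a21) (genB21 f) (f .a12) (genB12 f)
  t₂ : Cabled (f .c11) (f .a22) (f .b22) (f .a13) (f .b13)
  t₃ : Cabled (f .c21) (f .a31) (f .b31) (f .a22) (f .b22)
  t₄ : Cabled (f .c12) (f .a31) (f .b31) (f .a13) (f .b13)

/-- A compact form of the defining relations of the base group. -/
structure BaseRel (f : Gen → G) : Prop extends CabledRel f where
  c11_a31 : Commute (f .c11) (f .a31)
  c11_b31 : Commute (f .c11) (f .b31)
  d_a13 : Commute (f .c21 * (f .b31 * f .a31) * (f .b22 * f .a22)⁻¹) (f .a13)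
  d_b13 : Commute (f .c21 * (f .b31 * f .a31) * (f .b22 * f .a22)⁻¹) (f .b13)
  a_swap : f .c11 * (f .a22 * (f .a13)⁻¹) * f .c12 = f .c12 * (f .a22 * (f .a13)⁻¹) * f .c11
  b_swap : f .c11 * (f .b22 * (f .b13)⁻¹) * f .c12 = f .c12 * (f .b22 * (f .b13)⁻¹) * f .c11

theorem isYB_iff_cabledRel {l : Fin 4 → Fin 4 → G} (hd : ∀ i, l i i = 1) (hc : DisjointComm l) :
    IsYB l ↔ CabledRel (cabledGen l) := by
  have e₁ : Triple (l 0 1) (l 1 0) (l 0 2) (l 2 0) (l 1 2) (l 2 1) ↔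
      Cabled (cabledGen l .c11) (cabledGen l .a21) (genB21 (cabledGen l)) (cabledGen l .a12)
        (genB12 (cabledGen l)) := by
    rw [triple_iff_cabled]
    simp only [genB21, genB12, cabledGen, mul_inv_cancel_right]
  have e₂ : Triple (l 0 1) (l 1 0) (l 0 3 * l 0 2) (l 2 0 * l 3 0) (l 1 3 * l 1 2)
      (l 2 1 * l 3 1) ↔ Cabled (cabledGen l .c11) (cabledGen l .a22) (cabledGen l .b22)
        (cabledGen l .a13) (cabledGen l .b13) := by
    rw [triple_iff_cabled]
    have k₁ : l 0 3 * l 0 2 * (l 1 3 * l 1 2) = cabledGen l .a22 := by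
      calc _ = l 0 3 * (l 0 2 * l 1 3) * l 1 2 := by group
        _ = _ := by rw [hc.c₁₃₂₄.eq, cabledGen]; group
    have k₂ : l 2 1 * l 3 1 * (l 2 0 * l 3 0) = cabledGen l .b22 := by
      calc _ = l 2 1 * (l 3 1 * l 2 0) * l 3 0 := by group
        _ = _ := by rw [← hc.c₃₁₄₂.eq, cabledGen]; group
    rw [k₁, k₂]
    simp only [cabledGen, mul_assoc]
  have e₃ : Triple (l 0 2 * l 1 2) (l 2 1 * l 2 0) (l 0 3 * l 1 3) (l 3 1 * l 3 0) (l 2 3) (l 3 2) ↔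
      Cabled (cabledGen l .c21) (cabledGen l .a31) (cabledGen l .b31)
        (cabledGen l .a22) (cabledGen l .b22) := by
    rw [triple_iff_cabled]
    simp only [cabledGen, mul_assoc]
  have e₄ : Triple (l 0 2 * l 0 1) (l 1 0 * l 2 0) (l 0 3) (l 3 0) (l 1 3 * l 2 3)
      (l 3 2 * l 3 1) ↔ Cabled (cabledGen l .c12) (cabledGen l .a31) (cabledGen l .b31)
        (cabledGen l .a13) (cabledGen l .b13) := by
    rw [triple_iff_cabled]
    simp only [cabledGen, mul_assoc]
  constructor
  · intro h
    have h₁ := h.triple 0 1 2 (by decide) (by decide) (by decide)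
    have h₂ := h.triple 0 1 3 (by decide) (by decide) (by decide)
    have h₃ := h.triple 0 2 3 (by decide) (by decide) (by decide)
    have h₄ := h.triple 1 2 3 (by decide) (by decide) (by decide)
    exact ⟨e₁.1 h₁, e₂.1 ((triple_double_last hc h₁).2 h₂),
      e₃.1 ((triple_double_first hc h₃).2 h₄), e₄.1 ((triple_double_middle hc h₂).2 h₃)⟩
  -- The order matters: each doubling lemma needs the triple found just before, so `t₄` is used
  -- ahead of `t₃`.
  · intro ⟨t₁, t₂, t₃, t₄⟩
    have h₁ := e₁.2 t₁
    have h₂ := (triple_double_last hc h₁).1 (e₂.2 t₂)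
    have h₃ := (triple_double_middle hc h₂).1 (e₄.2 t₄)
    exact isYB_four hd hc h₁ h₂ h₃ ((triple_double_first hc h₃).1 (e₃.2 t₃))

/-- The extra commutations combine a three-strand one with disjointness: `c₁₁` commutes with
`λ₁₄λ₂₄` and with `λ₃₄`, while `c₂₁c₃₁c₂₂⁻¹` is `λ₄₃λ₃₄`, which commutes with `λ₁₄λ₁₃` and with
`λ₁₂`. The two exchange identities follow from Yang–Baxter moves after rewriting `a₂₂a₁₃⁻¹` and
`b₂₂b₁₃⁻¹`. -/
theorem IsYB.baseRel {l : Fin 4 → Fin 4 → G} (h : IsYB l) : BaseRel (cabledGen l) := by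
  have hc := h.disjointComm
  have h₁ := h.triple 0 1 2 (by decide) (by decide) (by decide)
  have h₂ := h.triple 0 1 3 (by decide) (by decide) (by decide)
  have h₃ := h.triple 0 2 3 (by decide) (by decide) (by decide)
  have h₄ := h.triple 1 2 3 (by decide) (by decide) (by decide)
  have g₂ := triple_iff_cabled.1 h₂
  have g₃ := triple_iff_cabled.1 h₃
  have g₃a := h₃.cabled_eq ▸ g₃.comm_a'
  have g₃b := h₃.cabled_eq ▸ g₃.comm_b'
  have cr := (isYB_iff_cabledRel h.diag hc).1 h
  have hd : cabledGen l .c21 * (cabledGen l .b31 * cabledGen l .a31) *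
      (cabledGen l .b22 * cabledGen l .a22)⁻¹ = l 3 2 * l 2 3 := by
    rw [← ((triple_double_first hc h₃).2 h₄).cabled_eq]
    simp only [cabledGen, mul_assoc]
  refine ⟨cr, ?_, ?_, ?_, ?_, ?_, ?_⟩
  · exact g₂.comm_ca.mul_right (hc.c₂₁₃₄.mul_left hc.c₁₂₃₄)
  · have := (hc.c₂₁₄₃.mul_left hc.c₁₂₄₃).mul_right g₂.comm_cb
    rwa [← mul_assoc] at this
  · rw [hd]
    have := g₃a.mul_right (hc.c₁₂₄₃.symm.mul_left hc.c₁₂₃₄.symm)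
    rwa [mul_assoc (l 0 3)] at this
  · rw [hd]
    have := (hc.c₂₁₄₃.symm.mul_left hc.c₂₁₃₄.symm).mul_right g₃b
    rwa [← mul_assoc (l 1 0)] at this
  · have hw : cabledGen l .a22 * (cabledGen l .a13)⁻¹ = (l 0 1)⁻¹ * (l 1 3 * l 1 2) := by
      rw [mul_inv_eq_iff_eq_mul, mul_assoc, eq_inv_mul_iff_mul_eq]
      simp only [cabledGen]
      calc _ = (l 0 1 * l 0 3 * l 1 3) * (l 0 2 * l 1 2) := by group
        _ = l 1 3 * l 0 3 * (l 0 1 * l 0 2 * l 1 2) := by rw [h₂.h₁₂₃]; group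
        _ = l 1 3 * (l 0 3 * l 1 2) * l 0 2 * l 0 1 := by rw [h₁.h₁₂₃]; group
        _ = _ := by rw [← hc.c₂₃₁₄.eq]; group
    rw [hw]
    simp only [cabledGen]
    calc _ = l 1 0 * l 1 3 * (l 1 2 * l 1 0 * l 2 0) * l 0 2 * l 0 1 := by group
      _ = l 1 0 * (l 1 3 * l 2 0) * l 1 0 * l 1 2 * l 0 2 * l 0 1 := by rw [h₁.h₂₃₁]; group
      _ = l 1 0 * l 2 0 * l 1 3 * (l 1 0 * l 1 2 * l 0 2) * l 0 1 := by
        rw [← hc.c₃₁₂₄.eq]; group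
      _ = l 1 0 * l 2 0 * (l 1 3 * l 0 2) * l 1 2 * l 1 0 * l 0 1 := by rw [h₁.h₂₁₃]; group
      _ = _ := by rw [← hc.c₁₃₂₄.eq]; group
  · have hw : cabledGen l .b22 * (cabledGen l .b13)⁻¹ = l 2 1 * l 3 1 * (l 1 0)⁻¹ := by
      rw [mul_inv_eq_iff_eq_mul]
      simp only [cabledGen]
      calc _ = l 2 1 * (l 2 0 * l 3 1) * l 3 0 := by group
        _ = _ := by rw [hc.c₃₁₄₂.eq]; group
    rw [hw]
    simp only [cabledGen]
    calc _ = l 1 0 * l 0 1 * l 2 1 * (l 3 1 * l 2 0) * l 0 2 * l 0 1 := by group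
      _ = l 1 0 * (l 0 1 * l 2 1 * l 2 0) * l 3 1 * l 0 2 * l 0 1 := by rw [← hc.c₃₁₄₂.eq]; group
      _ = l 1 0 * l 2 0 * l 2 1 * l 0 1 * (l 3 1 * l 0 2) * l 0 1 := by rw [← h₁.h₃₁₂]; group
      _ = l 1 0 * l 2 0 * (l 2 1 * l 0 1 * l 0 2) * l 3 1 * l 0 1 := by rw [← hc.c₁₃₄₂.eq]; group
      _ = _ := by rw [← h₁.h₁₃₂]; group

/-- The generators of the associated subgroup `A`. -/
def aWord (f : Gen → G) : Fin 6 → G :=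
  ![f .a21 * (f .a22)⁻¹ * f .a31,
    f .a12 * (f .a13)⁻¹ * f .a22 * (f .a21)⁻¹,
    f .a13 * (f .a12)⁻¹,
    f .b31 * (f .b22)⁻¹ * genB21 f,
    (genB21 f)⁻¹ * f .b22 * (f .b13)⁻¹ * genB12 f,
    (genB12 f)⁻¹ * f .b13]

/-- The generators of the associated subgroup `B`. -/
def bWord (f : Gen → G) : Fin 6 → G :=
  ![aWord f 0, cj (aWord f 1) (f .a12), cj (aWord f 2) ((f .a21)⁻¹ * f .a12),
    aWord f 3, cj (aWord f 4) (f .a12), cj (aWord f 5) ((f .a21)⁻¹ * f .a12)]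

/-- The elements `λ_{ij}` in terms of the generators of the base group and the stable letter. -/
def lamOf (f : Gen → G) (t : G) : Fin 4 → Fin 4 → G :=
  ![![1, t, f .a12 * t⁻¹, aWord f 2],
    ![f .c11 * t⁻¹, 1, t * (f .a12)⁻¹ * f .a21, aWord f 1],
    ![t * (f .c11)⁻¹ * genB12 f, genB21 f * (genB12 f)⁻¹ * f .c11 * t⁻¹, 1, aWord f 0],
    ![aWord f 5, aWord f 4, aWord f 3, 1]]

/-- One half of the change of generators, valid in any group without relations. The other half is
`lamOf_cabledGen`. -/
theorem cabledGen_lamOf (f : Gen → G) (t : G) : cabledGen (lamOf f t) = f := by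
  funext x
  cases x <;> simp [cabledGen, lamOf, aWord, genB21, genB12, mul_assoc]

theorem mul_inv_mul_mul_of_commute {x y z p q u : G} (hp : Commute (y * u * p⁻¹) p)
    (hq : Commute (y * u * p⁻¹) q) :
    x * y * z⁻¹ = (x * p * q⁻¹) * (y * u * p⁻¹) * (z * u * q⁻¹)⁻¹ := by
  symm
  calc _ = x * p * q⁻¹ * ((y * u * p⁻¹) * q) * u⁻¹ * z⁻¹ := by group
    _ = x * (p * (y * u * p⁻¹)) * u⁻¹ * z⁻¹ := by rw [hq.eq]; group
    _ = _ := by rw [← hp.eq]; group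

/-- Conjugation by `t` and by `y` agree on `x` exactly when `y * t⁻¹` centralizes `x`. This explains
the words for `B`: `a₁₂ = λ₁₃a₁₁` with `λ₁₃` commuting with `λ₂₄` and `λ₄₂`, and `a₂₁⁻¹a₁₂ =
λ₂₃⁻¹a₁₁` with `λ₂₃` commuting with `λ₁₄` and `λ₄₁`. -/
theorem commute_of_mul_eq_mul_cj {x y t : G} (h : x * t = t * cj x y) : Commute (y * t⁻¹) x := by
  have e : t⁻¹ * x = cj x y * t⁻¹ := by
    rw [eq_mul_inv_iff_mul_eq, mul_assoc, h, inv_mul_cancel_left]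
  unfold Commute SemiconjBy
  rw [mul_assoc, e, cj]
  group

theorem mul_eq_mul_cj {x y t : G} (h : Commute (y * t⁻¹) x) : x * t = t * cj x y := by
  have e : y = (y * t⁻¹) * t := by group
  rw [e, cj]
  calc x * t = t * t⁻¹ * (y * t⁻¹)⁻¹ * ((y * t⁻¹) * x) * t := by group
    _ = _ := by rw [h.eq]; group

/-- The relations of the base group and of the stable letter imply those of the virtual pure braid
group. -/
theorem BaseRel.isYB {f : Gen → G} {t : G} (h : BaseRel f)
    (ht : ∀ i, aWord f i * t = t * bWord f i) : IsYB (lamOf f t) := by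
  obtain ⟨l, hl⟩ : ∃ l, l = lamOf f t := ⟨_, rfl⟩
  have hf : f = cabledGen l := by rw [hl, cabledGen_lamOf]
  have ea : ∀ i, aWord f i = ![l 2 3, l 1 3, l 0 3, l 3 2, l 3 1, l 3 0] i := by
    intro i
    rw [hl]
    fin_cases i <;> rfl
  have e₀₁ : l 0 1 = t := by rw [hl]; rfl
  have e₀₂ : l 0 2 = f .a12 * t⁻¹ := by rw [hl]; rfl
  have e₁₂ : l 1 2 = t * (f .a12)⁻¹ * f .a21 := by rw [hl]; rfl
  have e₁₀ : l 1 0 = f .c11 * t⁻¹ := by rw [hl]; rfl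
  have e₀₃ : l 0 3 = f .a13 * (f .a12)⁻¹ := by rw [hl]; rfl
  have e₃₀ : l 3 0 = (genB12 f)⁻¹ * f .b13 := by rw [hl]; rfl
  have e₁₃ : l 1 3 = f .a12 * (f .a13)⁻¹ * f .a22 * (f .a21)⁻¹ := by rw [hl]; rfl
  have e₃₁ : l 3 1 = (genB21 f)⁻¹ * f .b22 * (f .b13)⁻¹ * genB12 f := by rw [hl]; rfl
  have e₂₃ : l 2 3 = f .a21 * (f .a22)⁻¹ * f .a31 := by rw [hl]; rfl
  have e₃₂ : l 3 2 = f .b31 * (f .b22)⁻¹ * genB21 f := by rw [hl]; rfl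
  have hb21 : genB21 f = l 2 1 * l 2 0 := by
    simp only [hf, genB21, cabledGen, mul_inv_cancel_right]
  have hb12 : genB12 f = l 1 0 * l 2 0 := by
    simp only [hf, genB12, cabledGen, mul_inv_cancel_right]
  have ey : ((f .a21)⁻¹ * f .a12) * t⁻¹ = (l 1 2)⁻¹ := by rw [e₁₂]; group
  -- The six relations of the stable letter are six of the twelve disjoint commutations. The other
  -- six have to be extracted from the base relations.
  have c₁₂₃₄ : Commute (l 0 1) (l 2 3) := by
    have := ht 0
    simp only [bWord, ea] at this
    rw [e₀₁]
    exact this.symm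
  have c₁₂₄₃ : Commute (l 0 1) (l 3 2) := by
    have := ht 3
    simp only [bWord, ea] at this
    rw [e₀₁]
    exact this.symm
  have c₁₃₂₄ : Commute (l 0 2) (l 1 3) := by
    have := ht 1
    simp only [bWord, ea] at this
    rw [e₀₂]
    exact commute_of_mul_eq_mul_cj this
  have c₁₃₄₂ : Commute (l 0 2) (l 3 1) := by
    have := ht 4
    simp only [bWord, ea] at this
    rw [e₀₂]
    exact commute_of_mul_eq_mul_cj this
  have c₂₃₁₄ : Commute (l 1 2) (l 0 3) := by
    have := ht 2
    simp only [bWord, ea] at this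
    exact Commute.inv_left_iff.1 (ey ▸ commute_of_mul_eq_mul_cj this)
  have c₂₃₄₁ : Commute (l 1 2) (l 3 0) := by
    have := ht 5
    simp only [bWord, ea] at this
    exact Commute.inv_left_iff.1 (ey ▸ commute_of_mul_eq_mul_cj this)
  have c₂₁₃₄ : Commute (l 1 0) (l 2 3) := by
    have : Commute (f .c11) (l 2 3) := by
      rw [e₂₃]
      exact (h.t₁.comm_ca.mul_right h.t₂.comm_ca.inv_right).mul_right h.c11_a31
    rw [e₁₀]
    exact this.mul_left (e₀₁ ▸ c₁₂₃₄.inv_left)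
  have c₂₁₄₃ : Commute (l 1 0) (l 3 2) := by
    have : Commute (f .c11) (l 3 2) := by
      rw [e₃₂]
      exact (h.c11_b31.mul_right h.t₂.comm_cb.inv_right).mul_right h.t₁.comm_cb
    rw [e₁₀]
    exact this.mul_left (e₀₁ ▸ c₁₂₄₃.inv_left)
  have h₁ : Triple (l 0 1) (l 1 0) (l 0 2) (l 2 0) (l 1 2) (l 2 1) := by
    rw [triple_iff_cabled]
    have := h.t₁
    rw [hb21, hb12] at this
    simpa only [hf, cabledGen] using this
  -- `λ₂₃` already commutes with `λ₁₄` and `λ₄₁`, so for `λ₃₂` it suffices to treat `r = λ₃₂λ₂₃ =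
  -- c₁₁c₂₁c₁₂⁻¹`. It splits as `(c₁₁c₂₂c₁₃⁻¹)(c₂₁c₃₁c₂₂⁻¹)(c₁₂c₃₁c₁₃⁻¹)⁻¹`, and every factor
  -- commutes with `a₁₃` and `b₁₃`.
  obtain ⟨r, hr⟩ : ∃ r, r = l 2 1 * l 1 2 := ⟨_, rfl⟩
  have hr' : r = f .c11 * (genB21 f * f .a21) * (genB12 f * f .a12)⁻¹ := by
    rw [hr, ← h₁.cabled_eq, hb21, hb12]
    simp only [hf, cabledGen]
  have hrs : r = (f .c11 * (f .b22 * f .a22) * (f .b13 * f .a13)⁻¹) *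
      (f .c21 * (f .b31 * f .a31) * (f .b22 * f .a22)⁻¹) *
      (f .c12 * (f .b31 * f .a31) * (f .b13 * f .a13)⁻¹)⁻¹ := by
    have k₁ := h.t₃.comm_b'.mul_right h.t₃.comm_a'
    have k₂ := h.d_b13.mul_right h.d_a13
    rw [hr', ← mul_inv_mul_mul_of_commute k₁ k₂, genB21, genB12]
    simp only [inv_mul_cancel_right]
  have r₁₄ : Commute r (l 0 3) := by
    rw [e₀₃]
    refine Commute.mul_right ?_ (hr' ▸ h.t₁.comm_a').inv_right
    rw [hrs]
    exact (h.t₂.comm_a'.mul_left h.d_a13).mul_left h.t₄.comm_a'.inv_left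
  have r₄₁ : Commute r (l 3 0) := by
    rw [e₃₀]
    refine Commute.mul_right (hr' ▸ h.t₁.comm_b').inv_right ?_
    rw [hrs]
    exact (h.t₂.comm_b'.mul_left h.d_b13).mul_left h.t₄.comm_b'.inv_left
  have e₂₁ : l 2 1 = r * (l 1 2)⁻¹ := by rw [hr, mul_inv_cancel_right]
  have c₃₂₁₄ : Commute (l 2 1) (l 0 3) := e₂₁ ▸ r₁₄.mul_left c₂₃₁₄.inv_left
  have c₃₂₄₁ : Commute (l 2 1) (l 3 0) := e₂₁ ▸ r₄₁.mul_left c₂₃₄₁.inv_left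
  -- Modulo the relations on strands `1, 2, 3`, the first exchange identity says that `λ₂₄` commutes
  -- with `λ₃₁λ₁₃`, and `λ₁₃` is already known to commute with it. The second one yields
  -- `λ₃₁λ₄₂λ₃₁⁻¹ = λ₄₂` in the next step.
  have c₃₁₂₄ : Commute (l 2 0) (l 1 3) := by
    have hw : f .a22 * (f .a13)⁻¹ = (l 0 1)⁻¹ * (l 1 3 * l 1 2) := by
      have k := c₁₃₂₄.inv_left.eq
      have e : l 1 2 = (l 0 2)⁻¹ * f .a21 := by rw [e₁₂, e₀₂]; group
      rw [h.t₂.comm_a.inv_right.eq, e, ← mul_assoc (l 1 3), ← k, e₁₃, e₀₁, e₀₂]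
      group
    have hs := h.a_swap
    rw [hw] at hs
    simp only [hf, cabledGen] at hs
    have k : l 1 3 * (l 2 0 * l 0 2) = (l 2 0 * l 0 2) * l 1 3 := by
      rw [← mul_left_inj (l 1 2 * l 1 0 * l 0 1), ← mul_right_inj (l 1 0)]
      calc _ = l 1 0 * l 1 3 * l 2 0 * (l 0 2 * l 1 2 * l 1 0) * l 0 1 := by group
        _ = l 1 0 * l 1 3 * (l 2 0 * l 1 0 * l 1 2) * l 0 2 * l 0 1 := by rw [← h₁.h₂₁₃]; group
        _ = l 1 0 * l 1 3 * (l 1 2 * l 1 0 * l 2 0) * l 0 2 * l 0 1 := by rw [h₁.h₂₃₁]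
        _ = l 1 0 * l 0 1 * ((l 0 1)⁻¹ * (l 1 3 * l 1 2)) * (l 1 0 * l 2 0 * (l 0 2 * l 0 1)) := by
          group
        _ = _ := by rw [hs]; group
    have := (show Commute (l 2 0 * l 0 2) (l 1 3) from k.symm).mul_left c₁₃₂₄.inv_left
    rwa [mul_inv_cancel_right] at this
  have c₃₁₄₂ : Commute (l 2 0) (l 3 1) := by
    have hw : f .b22 * (f .b13)⁻¹ = l 2 1 * l 2 0 * l 3 1 * (l 2 0)⁻¹ * (l 1 0)⁻¹ := by
      rw [e₃₁, hb21, hb12]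
      group
    have hs := h.b_swap
    rw [hw] at hs
    simp only [hf, cabledGen] at hs
    have k : l 2 0 * l 3 1 * (l 2 0)⁻¹ = l 3 1 := by
      rw [← mul_left_inj (l 0 1), ← mul_right_inj (l 1 0 * l 2 0 * (l 2 1 * l 0 1 * l 0 2))]
      calc _ = l 1 0 * l 2 0 * (l 0 2 * l 0 1 * l 2 1) * l 2 0 * l 3 1 * (l 2 0)⁻¹ * l 0 1 := by
            rw [h₁.h₁₃₂]; group
        _ = l 1 0 * l 2 0 * (l 0 2 * l 0 1) * (l 2 1 * l 2 0 * l 3 1 * (l 2 0)⁻¹ * (l 1 0)⁻¹) *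
            (l 1 0 * l 0 1) := by group
        _ = l 1 0 * (l 0 1 * l 2 1 * l 2 0) * l 3 1 * l 0 2 * l 0 1 := by rw [← hs]; group
        _ = l 1 0 * l 2 0 * l 2 1 * l 0 1 * (l 3 1 * l 0 2) * l 0 1 := by rw [← h₁.h₃₁₂]; group
        _ = _ := by rw [← c₁₃₄₂.eq]; group
    exact mul_inv_eq_iff_eq_mul.1 k
  rw [← hl]
  refine (isYB_iff_cabledRel ?_ ⟨c₁₂₃₄, c₁₂₄₃, c₂₁₃₄, c₂₁₄₃, c₁₃₂₄, c₁₃₄₂, c₃₁₂₄, c₃₁₄₂, c₂₃₁₄,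
    c₂₃₄₁, c₃₂₁₄, c₃₂₄₁⟩).2 (hf ▸ h.toCabledRel)
  intro i
  rw [hl]
  fin_cases i <;> rfl

end Algebra

/-! ### Reduction of the listed relations to their compact form -/

section Relations

variable {G : Type*} [Group G]

theorem map_cj {H : Type*} [Group H] (φ : G →* H) (x y : G) : φ (cj x y) = cj (φ x) (φ y) := by
  simp [cj]

theorem map_cm {H : Type*} [Group H] (φ : G →* H) (x y : G) : φ (cm x y) = cm (φ x) (φ y) := by
  simp [cm]

theorem cj_inv (x y : G) : cj x⁻¹ y = (cj x y)⁻¹ := by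
  simp only [cj]
  group

theorem cj_eq_self {x y : G} (h : Commute y x) : cj x y = x := by
  rw [cj, mul_assoc, ← h.eq, inv_mul_cancel_left]

theorem commute_of_cj_eq_self {x y : G} (h : cj x y = x) : Commute y x := by
  rw [cj, mul_assoc, inv_mul_eq_iff_eq_mul] at h
  exact h.symm

theorem cj_mul_of_commute {x y z : G} (h : Commute y x) : cj x (y * z) = cj x z := by
  have e : cj x (y * z) = cj (cj x y) z := by simp only [cj]; group
  rw [e, cj_eq_self h]

theorem commute_of_cj_eq_cj {x y z : G} (h : cj x y = cj x z) : Commute (y * z⁻¹) x := by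
  apply commute_of_cj_eq_self
  have e : cj x (y * z⁻¹) = cj (cj x y) z⁻¹ := by simp only [cj]; group
  rw [e, h]
  simp only [cj]
  group

/-- With `z = c * c₂ * c₁⁻¹` one has `c = z * c₁ * c₂⁻¹`, and also `c⁻¹ = z⁻¹ * c₁⁻¹ * c₂` because
`z` commutes with `c₁` and `c` with `c₂`. As `z` centralizes `x`, it drops out of the conjugation
for either sign. -/
theorem cj_zpow_eq {c c₁ c₂ x : G} (hx : Commute (c * c₂ * c₁⁻¹) x)
    (h₁ : Commute (c * c₂ * c₁⁻¹) c₁) (h₂ : Commute c c₂) {ε : ℤ} (hε : ε = 1 ∨ ε = -1) :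
    cj x (c ^ ε) = cj x (c₁ ^ ε * c₂ ^ (-ε)) := by
  rcases hε with rfl | rfl
  · have e : c ^ (1 : ℤ) = (c * c₂ * c₁⁻¹) * (c₁ ^ (1 : ℤ) * c₂ ^ (-1 : ℤ)) := by group
    rw [e, cj_mul_of_commute hx]
  · have e : c ^ (-1 : ℤ) = (c * c₂ * c₁⁻¹)⁻¹ * (c₁ ^ (-1 : ℤ) * c₂ ^ (- -1 : ℤ)) := by
      calc c ^ (-1 : ℤ) = c₁⁻¹ * (c * c₂ * c₁⁻¹)⁻¹ * (c * c₂) * c⁻¹ := by group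
        _ = (c * c₂ * c₁⁻¹)⁻¹ * c₁⁻¹ * (c₂ * c) * c⁻¹ := by rw [h₁.inv_inv.eq, h₂.eq]
        _ = _ := by group
    rw [e, cj_mul_of_commute hx.inv_left]

theorem commute_of_cj_zpow_one {c c₁ c₂ x : G}
    (h : cj x (c ^ (1 : ℤ)) = cj x (c₁ ^ (1 : ℤ) * c₂ ^ (-1 : ℤ))) :
    Commute (c * c₂ * c₁⁻¹) x := by
  have := commute_of_cj_eq_cj h
  rwa [show c ^ (1 : ℤ) * (c₁ ^ (1 : ℤ) * c₂ ^ (-1 : ℤ))⁻¹ = c * c₂ * c₁⁻¹ by group] at this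

theorem Cabled.comm_mul {c a b a' b' : G} (h : Cabled c a b a' b') :
    Commute (c * (b * a) * (b' * a')⁻¹) (b' * a') := h.comm_b'.mul_right h.comm_a'

theorem Cabled.cj_a' {c a b a' b' : G} (h : Cabled c a b a' b') {ε : ℤ} (hε : ε = 1 ∨ ε = -1) :
    cj a' (c ^ ε) = cj a' ((b' * a') ^ ε * (b * a) ^ (-ε)) :=
  cj_zpow_eq h.comm_a' h.comm_mul (h.comm_cb.mul_right h.comm_ca) hε

theorem Cabled.cj_b' {c a b a' b' : G} (h : Cabled c a b a' b') {ε : ℤ} (hε : ε = 1 ∨ ε = -1) :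
    cj b' (c ^ ε) = cj b' ((b' * a') ^ ε * (b * a) ^ (-ε)) :=
  cj_zpow_eq h.comm_b' h.comm_mul (h.comm_cb.mul_right h.comm_ca) hε

theorem Cabled.cj_mul {c a b a' b' : G} (h : Cabled c a b a' b') {ε : ℤ} (hε : ε = 1 ∨ ε = -1) :
    cj (b' * a') (c ^ ε) = cj (b' * a') ((b * a) ^ (-ε)) := by
  rw [cj_zpow_eq h.comm_mul h.comm_mul (h.comm_cb.mul_right h.comm_ca) hε,
    cj_mul_of_commute ((Commute.refl _).zpow_left _)]

/-- Used with `p = c₁₁`, `q = c₁₂`, `x = a₂₂`, `y = a₁₃`: it turns the unwieldy formula for `a₂₂`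
conjugated by `c₁₂` into an identity symmetric in `c₁₁` and `c₁₂`. -/
theorem a_swap_iff {p q x y : G} (hxy : Commute x y) (hp : Commute p x) :
    cj x q = q⁻¹ * cj q p * cj y⁻¹ p * x * cj y q ↔ p * (x * y⁻¹) * q = q * (x * y⁻¹) * p := by
  have e₁ : cj x q = q⁻¹ * (x * y⁻¹) * (y * q) := by simp only [cj]; group
  have e₂ : q⁻¹ * cj q p * cj y⁻¹ p * x * cj y q =
      q⁻¹ * (p⁻¹ * (q * (x * y⁻¹) * p) * q⁻¹) * (y * q) := by
    simp only [cj]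
    calc _ = q⁻¹ * p⁻¹ * q * y⁻¹ * (p * x) * q⁻¹ * y * q := by group
      _ = q⁻¹ * p⁻¹ * q * (y⁻¹ * x) * p * q⁻¹ * y * q := by rw [hp.eq]; group
      _ = _ := by rw [← hxy.inv_right.eq]; group
  rw [e₁, e₂, mul_left_inj, mul_right_inj, eq_mul_inv_iff_mul_eq, eq_inv_mul_iff_mul_eq, mul_assoc p]

theorem b_swap_iff {p q x y : G} (hp : Commute p x) :
    cj x q = q⁻¹ * cj q p * x * cj y⁻¹ p * cj y q ↔ p * (x * y⁻¹) * q = q * (x * y⁻¹) * p := by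
  have e₁ : cj x q = q⁻¹ * (x * y⁻¹) * (y * q) := by simp only [cj]; group
  have e₂ : q⁻¹ * cj q p * x * cj y⁻¹ p * cj y q =
      q⁻¹ * (p⁻¹ * (q * (x * y⁻¹) * p) * q⁻¹) * (y * q) := by
    simp only [cj]
    calc _ = q⁻¹ * p⁻¹ * q * (p * x) * p⁻¹ * y⁻¹ * p * q⁻¹ * y * q := by group
      _ = _ := by rw [hp.eq]; group
  rw [e₁, e₂, mul_left_inj, mul_right_inj, eq_mul_inv_iff_mul_eq, eq_inv_mul_iff_mul_eq, mul_assoc p]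

theorem cj_inv_of_a_swap {p q x y : G} (hxy : Commute x y) (hp : Commute p x)
    (h : p * (x * y⁻¹) * q = q * (x * y⁻¹) * p) :
    cj x q⁻¹ = cj y q⁻¹ * cj y⁻¹ p⁻¹ * x * (cj q p⁻¹ * q⁻¹) := by
  symm
  simp only [cj]
  calc _ = q * y * q⁻¹ * p * y⁻¹ * (p⁻¹ * x) * p * q * p⁻¹ * q⁻¹ := by group
    _ = q * y * q⁻¹ * p * (y⁻¹ * x) * q * p⁻¹ * q⁻¹ := by rw [hp.inv_left.eq]; group
    _ = q * y * q⁻¹ * (p * (x * y⁻¹) * q) * p⁻¹ * q⁻¹ := by rw [← hxy.inv_right.eq]; group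
    _ = q * (y * x) * y⁻¹ * q⁻¹ := by rw [h]; group
    _ = _ := by rw [← hxy.eq]; group

theorem cj_inv_of_b_swap {p q x y : G} (hxy : Commute x y)
    (h : p * (x * y⁻¹) * q = q * (x * y⁻¹) * p) (hp : Commute p x) :
    cj x q⁻¹ = cj y q⁻¹ * x * cj y⁻¹ p⁻¹ * (cj q p⁻¹ * q⁻¹) := by
  symm
  simp only [cj]
  calc _ = q * y * q⁻¹ * (x * p) * y⁻¹ * q * p⁻¹ * q⁻¹ := by group
    _ = q * y * q⁻¹ * (p * (x * y⁻¹) * q) * p⁻¹ * q⁻¹ := by rw [← hp.eq]; group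
    _ = q * (y * x) * y⁻¹ * q⁻¹ := by rw [h]; group
    _ = _ := by rw [← hxy.eq]; group

theorem cm_eq_one_iff {x y : G} : cm x y = 1 ↔ Commute x y := by
  rw [cm, mul_assoc, ← mul_inv_rev, inv_mul_eq_one, eq_comm]
  rfl

theorem lift_rels_iff {f : Gen → G} : (∀ r ∈ G4Rels, FreeGroup.lift f r = 1) ↔
    (∀ ε : ℤ, (ε = 1 ∨ ε = -1) → ∀ p ∈ W.conjC11 ε ++ W.conjC21 ε ++ W.conjC12 ε,
      FreeGroup.lift f p.1 = FreeGroup.lift f p.2) ∧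
    ∀ p ∈ W.conjC12' ++ W.commut, FreeGroup.lift f p.1 = FreeGroup.lift f p.2 := by
  constructor
  · intro h
    have key {p : FreeGroup Gen × FreeGroup Gen} (hp : (∃ ε : ℤ, (ε = 1 ∨ ε = -1) ∧
        p ∈ W.conjC11 ε ++ W.conjC21 ε ++ W.conjC12 ε) ∨ p ∈ W.conjC12' ++ W.commut) :
        FreeGroup.lift f p.1 = FreeGroup.lift f p.2 := by
      have := h (p.1 * p.2⁻¹) ⟨p.1, p.2, rfl, hp⟩
      rwa [map_mul, map_inv, mul_inv_eq_one] at this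
    exact ⟨fun ε hε p hp => key (Or.inl ⟨ε, hε, hp⟩), fun p hp => key (Or.inr hp)⟩
  · rintro ⟨h₁, h₂⟩ r ⟨u, v, rfl, ⟨ε, hε, hp⟩ | hp⟩
    · rw [map_mul, map_inv, mul_inv_eq_one]
      exact h₁ ε hε _ hp
    · rw [map_mul, map_inv, mul_inv_eq_one]
      exact h₂ _ hp

/-- A relation saying that `c` and `c₁ * c₂⁻¹` conjugate `x` alike means that `c * c₂ * c₁⁻¹`
centralizes `x`. In this form the relations become the commutations of four `Cabled` systems, a few
more commutations and the two exchange identities. -/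
theorem lift_rels_iff_baseRel {f : Gen → G} :
    (∀ r ∈ G4Rels, FreeGroup.lift f r = 1) ↔ BaseRel f := by
  rw [lift_rels_iff]
  simp only [W.conjC11, W.conjC21, W.conjC12, W.conjC12', W.commut, List.forall_mem_append,
    List.forall_mem_cons, List.not_mem_nil, false_imp_iff, implies_true, and_true, map_cj, map_cm,
    map_mul, map_inv, map_zpow, map_one, W.c11, W.a21, W.a12, W.c21, W.c12, W.a31, W.a22, W.a13,
    W.b31, W.b22, W.b13, W.c31, W.c22, W.c13, FreeGroup.lift_apply_of, cm_eq_one_iff]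
  have hc21 : genB21 f * f .a21 = f .c21 := inv_mul_cancel_right _ _
  have hc12 : genB12 f * f .a12 = f .c12 := inv_mul_cancel_right _ _
  -- Since `c₁₁` and `c₂₁⁻¹` conjugate `c₁₂` alike, and so do their inverses, the commutators of
  -- `c₁₂` and `c₂₁` can be written with `c₁₁`.
  have commutators (h : Cabled (f .c11) (f .a21) (genB21 f) (f .a12) (genB12 f)) :
      cm (f .c12) (f .c21)⁻¹ = (f .c12)⁻¹ * cj (f .c12) (f .c11) ∧
      cm (f .c21) (f .c12)⁻¹ = cj (f .c12) (f .c11)⁻¹ * (f .c12)⁻¹ := by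
    have e₁ := h.cj_mul (Or.inl rfl)
    have e₂ := h.cj_mul (Or.inr rfl)
    rw [hc21, hc12, zpow_one, zpow_neg_one] at e₁
    rw [hc21, hc12, neg_neg, zpow_one, zpow_neg_one] at e₂
    rw [e₁, e₂]
    simp only [cm, cj]
    constructor <;> group
  have conj_pos {c a b a' b' : G} (h : Cabled c a b a' b') :
      cj a' (b' * a' * (b * a)⁻¹) = cj a' c ∧ cj b' (b' * a' * (b * a)⁻¹) = cj b' c := by
    have e₁ := h.cj_a' (Or.inl rfl)
    have e₂ := h.cj_b' (Or.inl rfl)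
    simp only [zpow_one, zpow_neg_one] at e₁ e₂
    exact ⟨e₁.symm, e₂.symm⟩
  have conj_neg {c a b a' b' : G} (h : Cabled c a b a' b') :
      cj a' ((b' * a')⁻¹ * (b * a)) = cj a' c⁻¹ ∧ cj b' ((b' * a')⁻¹ * (b * a)) = cj b' c⁻¹ := by
    have e₁ := h.cj_a' (Or.inr rfl)
    have e₂ := h.cj_b' (Or.inr rfl)
    simp only [zpow_one, zpow_neg_one, neg_neg] at e₁ e₂
    exact ⟨e₁.symm, e₂.symm⟩
  constructor
  -- Only the relations for `ε = 1` enter here; those for `ε = -1` are consequences of them.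
  · rintro ⟨h, ⟨-, s₁, -, s₂⟩, k₁, k₂, k₃, k₄, k₅, k₆, k₇, k₈⟩
    obtain ⟨⟨⟨p₁, p₂, p₃, p₄, p₅, p₆, p₇, p₈, p₉, p₁₀⟩, q₁, q₂, q₃, q₄, q₅, q₆⟩, r₁, r₂, r₃, r₄⟩ :=
      h 1 (Or.inl rfl)
    have fix {x y : G} (h : cj x (y ^ (1 : ℤ)) = x) : Commute y x :=
      commute_of_cj_eq_self (by rwa [zpow_one] at h)
    have t₁ : Cabled (f .c11) (f .a21) (genB21 f) (f .a12) (genB12 f) := by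
      have e := commute_of_cj_zpow_one p₂
      have e' := commute_of_cj_eq_cj p₄
      rw [zpow_one, zpow_neg_one, inv_inv] at e'
      refine ⟨k₁, k₅, fix p₁, (fix p₃).mul_right (fix p₁).inv_right, ?_, ?_⟩
      · rwa [hc21, hc12]
      · rw [hc21, hc12]
        exact (e'.mul_left (Commute.refl _).inv_left).mul_right e.inv_right
    have t₂ : Cabled (f .c11) (f .a22) (f .b22) (f .a13) (f .b13) :=
      ⟨k₄, k₈, fix p₆, fix p₉, commute_of_cj_zpow_one p₇, commute_of_cj_zpow_one p₁₀⟩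
    have t₃ : Cabled (f .c21) (f .a31) (f .b31) (f .a22) (f .b22) :=
      ⟨k₂, k₆, fix q₁, fix q₄, commute_of_cj_zpow_one q₂, commute_of_cj_zpow_one q₅⟩
    have t₄ : Cabled (f .c12) (f .a31) (f .b31) (f .a13) (f .b13) :=
      ⟨k₃, k₇, fix r₁, fix r₃, commute_of_cj_zpow_one r₂, commute_of_cj_zpow_one r₄⟩
    refine ⟨⟨t₁, t₂, t₃, t₄⟩, fix p₅, fix p₈, commute_of_cj_zpow_one q₃,
      commute_of_cj_zpow_one q₆, ?_, ?_⟩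
    · rw [← a_swap_iff k₄ (fix p₆), s₁, (commutators t₁).1, cj_inv, cj_inv, (conj_pos t₂).1,
        (conj_pos t₄).1]
    · rw [← b_swap_iff (fix p₉), s₂, (commutators t₁).1, cj_inv, cj_inv, (conj_pos t₂).2,
        (conj_pos t₄).2]
  · intro h
    have fix {x y : G} (h : Commute y x) (ε : ℤ) : cj x (y ^ ε) = x :=
      cj_eq_self (h.zpow_left ε)
    have k₁ := h.t₁.comm_cb.mul_right h.t₁.comm_ca
    have k₂ := h.t₃.comm_cb.mul_right h.t₃.comm_ca
    rw [hc21] at k₁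
    have a_swap := h.a_swap
    have b_swap := h.b_swap
    refine ⟨fun ε hε => ⟨⟨⟨fix h.t₁.comm_ca ε, ?_, fix k₁ ε, ?_, fix h.c11_a31 ε,
      fix h.t₂.comm_ca ε, h.t₂.cj_a' hε, fix h.c11_b31 ε, fix h.t₂.comm_cb ε, h.t₂.cj_b' hε⟩,
      fix h.t₃.comm_ca ε, h.t₃.cj_a' hε, cj_zpow_eq h.d_a13 h.t₃.comm_mul k₂ hε,
      fix h.t₃.comm_cb ε, h.t₃.cj_b' hε, cj_zpow_eq h.d_b13 h.t₃.comm_mul k₂ hε⟩,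
      fix h.t₄.comm_ca ε, h.t₄.cj_a' hε, fix h.t₄.comm_cb ε, h.t₄.cj_b' hε⟩, ⟨?_, ?_, ?_, ?_⟩,
      h.t₁.comm_a, h.t₃.comm_a, h.t₄.comm_a, h.t₂.comm_a,
      h.t₁.comm_b, h.t₃.comm_b, h.t₄.comm_b, h.t₂.comm_b⟩
    · have := h.t₁.cj_a' hε
      rwa [hc21, hc12] at this
    · have := h.t₁.cj_mul hε
      rwa [hc21, hc12] at this
    · rw [cj_inv_of_a_swap h.t₂.comm_a h.t₂.comm_ca a_swap, (commutators h.t₁).2, cj_inv, cj_inv,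
        (conj_neg h.t₂).1, (conj_neg h.t₄).1]
    · rw [(a_swap_iff h.t₂.comm_a h.t₂.comm_ca).2 a_swap, (commutators h.t₁).1, cj_inv, cj_inv,
        (conj_pos h.t₂).1, (conj_pos h.t₄).1]
    · rw [cj_inv_of_b_swap h.t₂.comm_b b_swap h.t₂.comm_cb, (commutators h.t₁).2, cj_inv, cj_inv,
        (conj_neg h.t₂).2, (conj_neg h.t₄).2]
    · rw [(b_swap_iff h.t₂.comm_cb).2 b_swap, (commutators h.t₁).1, cj_inv, cj_inv,
        (conj_pos h.t₂).2, (conj_pos h.t₄).2]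

end Relations

/-! ### The splitting `S_4 → VB_4` -/

section SymmetricGroup

theorem rel_eq {n : ℕ} {u v : FreeGroup (VBGen n)} (h : VBRel n u v) :
    (QuotientGroup.mk u : VB n) = QuotientGroup.mk v := by
  have : (PresentedGroup.mk (VBRels n)) (u * v⁻¹) = 1 :=
    PresentedGroup.one_of_mem ⟨u, v, h, rfl⟩
  rwa [map_mul, map_inv, mul_inv_eq_one] at this

theorem rho_mul_self {n : ℕ} (i : Fin (n - 1)) : (rho i * rho i : VB n) = 1 :=
  rel_eq (VBRel.rho_sq i)

theorem rho_inv {n : ℕ} (i : Fin (n - 1)) : (rho i : VB n)⁻¹ = rho i :=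
  inv_eq_of_mul_eq_one_left (rho_mul_self i)

theorem rho_mul_self_mul {n : ℕ} (i : Fin (n - 1)) (x : VB n) : rho i * (rho i * x) = x := by
  rw [← mul_assoc, rho_mul_self, one_mul]

theorem rho_braid {n : ℕ} (i j : Fin (n - 1)) (h : i.val + 1 = j.val) :
    (rho i * rho j * rho i : VB n) = rho j * rho i * rho j :=
  rel_eq (VBRel.rho_braid i j h)

theorem rho_comm {n : ℕ} (i j : Fin (n - 1)) (h : i.val + 1 < j.val) :
    (rho i * rho j : VB n) = rho j * rho i :=
  rel_eq (VBRel.rho_comm i j h)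

theorem sigma_rho_comm {n : ℕ} (i j : Fin (n - 1))
    (h : i.val + 1 < j.val ∨ j.val + 1 < i.val) : (sigma i * rho j : VB n) = rho j * sigma i :=
  rel_eq (VBRel.mixed_comm i j h)

theorem sigma_comm {n : ℕ} (i j : Fin (n - 1)) (h : i.val + 1 < j.val) :
    (sigma i * sigma j : VB n) = sigma j * sigma i :=
  rel_eq (VBRel.sigma_comm i j h)

theorem sigma_braid {n : ℕ} (i j : Fin (n - 1)) (h : i.val + 1 = j.val) :
    (sigma i * sigma j * sigma i : VB n) = sigma j * sigma i * sigma j :=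
  rel_eq (VBRel.braid i j h)

theorem mixed_braid {n : ℕ} (i j : Fin (n - 1)) (h : i.val + 1 = j.val) :
    (rho i * rho j * sigma i : VB n) = sigma j * rho i * rho j :=
  rel_eq (VBRel.mixed_braid i j h)

theorem sigma_inv_rho_rho {n : ℕ} (i j : Fin (n - 1)) (h : i.val + 1 = j.val) :
    ((sigma i)⁻¹ * rho j * rho i : VB n) = rho j * rho i * (sigma j)⁻¹ := by
  have := congrArg (·⁻¹) (mixed_braid i j h)
  simpa only [mul_inv_rev, rho_inv, ← mul_assoc] using this

theorem conj_rho_mul_sigma_inv {n : ℕ} (i j : Fin (n - 1)) (h : i.val + 1 = j.val) :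
    rho i * (rho j * (rho i * (sigma i)⁻¹) * rho j) * rho i = (rho j * (sigma j)⁻¹ : VB n) := by
  calc _ = rho i * rho j * rho i * ((sigma i)⁻¹ * rho j * rho i) := by group
    _ = rho j * rho i * (rho j * rho j) * rho i * (sigma j)⁻¹ := by
      rw [sigma_inv_rho_rho i j h, rho_braid i j h]; group
    _ = rho j * (rho i * rho i) * (sigma j)⁻¹ := by rw [rho_mul_self]; group
    _ = _ := by rw [rho_mul_self, mul_one]

/-- The mixed relations carry the `ρ`'s past the `σ⁻¹`'s, and what remains is the braid relation for
the inverses of the `σ`'s. -/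
theorem ybe_rho_sigma {n : ℕ} (i j : Fin (n - 1)) (h : i.val + 1 = j.val) :
    YBE (rho i * (sigma i)⁻¹ : VB n) (rho j * (rho i * (sigma i)⁻¹) * rho j)
      (rho j * (sigma j)⁻¹) := by
  have m := sigma_inv_rho_rho i j h
  have b := rho_braid i j h
  have s : ((sigma i)⁻¹ * (sigma j)⁻¹ * (sigma i)⁻¹ : VB n) =
      (sigma j)⁻¹ * (sigma i)⁻¹ * (sigma j)⁻¹ := by
    have := congrArg (·⁻¹) (sigma_braid i j h)
    simpa only [mul_inv_rev, ← mul_assoc] using this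
  have m' : ((sigma j)⁻¹ * rho i * rho j : VB n) = rho i * rho j * (sigma i)⁻¹ := by
    rw [← mul_left_inj (rho j * rho i), ← mul_right_inj (rho j * rho i)]
    calc _ = rho j * rho i * (sigma j)⁻¹ * rho i * (rho j * rho j) * rho i := by group
      _ = (sigma i)⁻¹ * rho j * rho i := by
        rw [rho_mul_self, mul_one, mul_assoc, rho_mul_self, mul_one, m]
      _ = rho j * (rho i * rho i) * rho j * ((sigma i)⁻¹ * rho j * rho i) := by
        rw [rho_mul_self, mul_one, rho_mul_self, one_mul]
      _ = _ := by group
  unfold YBE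
  calc _ = rho i * ((sigma i)⁻¹ * rho j * rho i) * (sigma i)⁻¹ * (rho j * rho j) * (sigma j)⁻¹ := by
        group
    _ = rho j * rho i * rho j * ((sigma j)⁻¹ * (sigma i)⁻¹ * (sigma j)⁻¹) := by
      rw [m, rho_mul_self, ← b]; group
    _ = rho j * (rho i * rho j * (sigma i)⁻¹) * (sigma j)⁻¹ * (sigma i)⁻¹ := by rw [← s]; group
    _ = rho j * (sigma j)⁻¹ * (rho i * rho j) * (sigma j)⁻¹ * (sigma i)⁻¹ := by rw [← m']; group
    _ = rho j * (sigma j)⁻¹ * (rho i * rho j * rho i) * rho i * (sigma j)⁻¹ * (sigma i)⁻¹ := by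
      rw [← mul_assoc (rho j * (sigma j)⁻¹), ← mul_assoc (rho j * (sigma j)⁻¹),
        mul_assoc _ (rho i) (rho i), rho_mul_self, mul_one, ← mul_assoc]
    _ = rho j * (sigma j)⁻¹ * rho j * rho i * (rho j * rho i * (sigma j)⁻¹) * (sigma i)⁻¹ := by
      rw [b]; group
    _ = _ := by rw [← m]; group

/-- The subgroup generated by the `ρ_i`. -/
def rhoSubgroup : Subgroup (VB 4) := Subgroup.closure (Set.range rho)

variable {G : Type*} [Group G]

/-- The 24 normal forms of the symmetric group on four letters as words in the simple
transpositions. -/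
def coxeterWord (r : Fin 3 → G) (w : Fin 2 × Fin 3 × Fin 4) : G :=
  ![1, r 0] w.1 * (![1, r 1, r 1 * r 0] w.2.1 * ![1, r 2, r 2 * r 1, r 2 * r 1 * r 0] w.2.2)

theorem map_coxeterWord {H : Type*} [Group H] (φ : G →* H) (r : Fin 3 → G)
    (w : Fin 2 × Fin 3 × Fin 4) : φ (coxeterWord r w) = coxeterWord (fun i => φ (r i)) w := by
  obtain ⟨a, b, c⟩ := w
  fin_cases a <;> fin_cases b <;> fin_cases c <;> simp [coxeterWord]

theorem exists_coxeterWord_mul {r : Fin 3 → G} (h₀ : r 0 * r 0 = 1) (h₁ : r 1 * r 1 = 1)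
    (h₂ : r 2 * r 2 = 1) (h₀₁ : r 0 * r 1 * r 0 = r 1 * r 0 * r 1)
    (h₁₂ : r 1 * r 2 * r 1 = r 2 * r 1 * r 2) (h₀₂ : r 0 * r 2 = r 2 * r 0)
    (w : Fin 2 × Fin 3 × Fin 4) (i : Fin 3) : ∃ w', coxeterWord r w * r i = coxeterWord r w' := by
  have e₁ (w : Fin 2) : ∃ w', ![1, r 0] w * r 0 = ![1, r 0] w' := by
    fin_cases w
    · exact ⟨1, by simp⟩
    · exact ⟨0, by simp [h₀]⟩
  have e₂ (a : Fin 2) (b : Fin 3) (i : Fin 3) (hi : i ≠ 2) : ∃ a' b', ![1, r 0] a *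
      ![1, r 1, r 1 * r 0] b * r i = ![1, r 0] a' * ![1, r 1, r 1 * r 0] b' := by
    obtain ⟨a', ha'⟩ := e₁ a
    fin_cases i
    · fin_cases b
      · exact ⟨a', 0, by simpa using ha'⟩
      · exact ⟨a, 2, by simp [mul_assoc]⟩
      · exact ⟨a, 1, by simp [mul_assoc, h₀]⟩
    · fin_cases b
      · exact ⟨a, 1, by simp⟩
      · exact ⟨a, 0, by simp [mul_assoc, h₁]⟩
      · refine ⟨a', 2, ?_⟩
        rw [← ha']
        simp only [mul_assoc] at h₀₁
        simp [mul_assoc, h₀₁]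
    · exact absurd rfl hi
  obtain ⟨a, b, c⟩ := w
  obtain ⟨a₀, b₀, k₀⟩ := e₂ a b 0 (by decide)
  obtain ⟨a₁, b₁, k₁⟩ := e₂ a b 1 (by decide)
  simp only [coxeterWord, Prod.exists]
  simp only [← mul_assoc]
  fin_cases i
  · fin_cases c
    · exact ⟨a₀, b₀, 0, by simpa using k₀⟩
    · refine ⟨a₀, b₀, 1, ?_⟩
      rw [← k₀]
      simp [mul_assoc, h₀₂]
    · exact ⟨a, b, 3, by simp [mul_assoc]⟩
    · exact ⟨a, b, 2, by simp [mul_assoc, h₀]⟩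
  · fin_cases c
    · exact ⟨a₁, b₁, 0, by simpa using k₁⟩
    · exact ⟨a, b, 2, by simp [mul_assoc]⟩
    · exact ⟨a, b, 1, by simp [mul_assoc, h₁]⟩
    · refine ⟨a₀, b₀, 3, ?_⟩
      rw [← k₀]
      simp only [mul_assoc] at h₀₁
      have : r 0 * (r 2 * (r 1 * r 0)) = r 2 * (r 1 * (r 0 * r 1)) := by
        rw [← mul_assoc, h₀₂, mul_assoc, h₀₁]
      simp [mul_assoc, this]
  · fin_cases c
    · exact ⟨a, b, 1, by simp⟩
    · exact ⟨a, b, 0, by simp [mul_assoc, h₂]⟩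
    · refine ⟨a₁, b₁, 2, ?_⟩
      rw [← k₁]
      simp only [mul_assoc] at h₁₂
      simp [mul_assoc, h₁₂]
    · refine ⟨a₁, b₁, 3, ?_⟩
      rw [← k₁]
      have : r 1 * (r 2 * (r 1 * r 0)) = r 2 * (r 1 * (r 0 * r 2)) := by
        rw [h₀₂, ← mul_assoc, ← mul_assoc, h₁₂]
        simp only [mul_assoc]
      simp [mul_assoc, this]

theorem exists_coxeterWord_eq {x : VB 4} (hx : x ∈ rhoSubgroup) :
    ∃ w, x = coxeterWord (rho (n := 4)) w := by
  refine Subgroup.closure_induction_right (p := fun x _ => ∃ w, x = coxeterWord (rho (n := 4)) w)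
    ⟨(0, 0, 0), by simp [coxeterWord]⟩ ?_ ?_ hx
  all_goals
    rintro x - _ ⟨i, rfl⟩ ⟨w, rfl⟩
    try rw [rho_inv]
    exact exists_coxeterWord_mul (rho_mul_self 0) (rho_mul_self 1) (rho_mul_self 2)
      (rho_braid 0 1 rfl) (rho_braid 1 2 rfl) (rho_comm 0 2 (by decide)) w i

theorem coxeterWord_transp_bijective : Function.Bijective (coxeterWord (transp (n := 4))) := by
  rw [Fintype.bijective_iff_injective_and_card]
  exact ⟨by decide +kernel, by decide⟩

/-- The restriction of `VB_4 → S_4` to the subgroup generated by the `ρ_i`. -/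
def rhoToPerm : rhoSubgroup →* Equiv.Perm (Fin 4) := (toPerm 4).comp rhoSubgroup.subtype

/-- The Coxeter relations leave at most 24 elements in the subgroup, each a normal form, and the 24
normal forms have distinct images that exhaust `S_4`. -/
theorem rhoToPerm_bijective : Function.Bijective rhoToPerm := by
  have key (w) : toPerm 4 (coxeterWord (rho (n := 4)) w) = coxeterWord (transp (n := 4)) w := by
    rw [map_coxeterWord]
    congr
  constructor
  · rintro ⟨x, hx⟩ ⟨y, hy⟩ hxy
    obtain ⟨w, rfl⟩ := exists_coxeterWord_eq hx
    obtain ⟨w', rfl⟩ := exists_coxeterWord_eq hy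
    have : toPerm 4 (coxeterWord (rho (n := 4)) w) = toPerm 4 (coxeterWord (rho (n := 4)) w') := hxy
    rw [key, key] at this
    rw [Subtype.mk.injEq, coxeterWord_transp_bijective.1 this]
  · intro p
    obtain ⟨w, rfl⟩ := coxeterWord_transp_bijective.2 p
    have hm (i) : rho i ∈ rhoSubgroup := Subgroup.subset_closure ⟨i, rfl⟩
    refine ⟨coxeterWord (fun i => ⟨rho i, hm i⟩) w, ?_⟩
    rw [map_coxeterWord]
    congr

/-- The splitting `S_4 → VB_4` that sends the simple transpositions to the `ρ_i`. -/
noncomputable def permToVB : Equiv.Perm (Fin 4) →* VB 4 :=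
  rhoSubgroup.subtype.comp (MulEquiv.ofBijective rhoToPerm rhoToPerm_bijective).symm.toMonoidHom

theorem permToVB_mem (w : Equiv.Perm (Fin 4)) : permToVB w ∈ rhoSubgroup := Subtype.prop _

theorem toPerm_permToVB (w : Equiv.Perm (Fin 4)) : toPerm 4 (permToVB w) = w :=
  (MulEquiv.ofBijective rhoToPerm rhoToPerm_bijective).apply_symm_apply w

theorem permToVB_transp (i : Fin 3) : permToVB (transp (n := 4) i) = rho (n := 4) i := by
  have hm : rho (n := 4) i ∈ rhoSubgroup := Subgroup.subset_closure ⟨i, rfl⟩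
  have : (MulEquiv.ofBijective rhoToPerm rhoToPerm_bijective).symm (transp (n := 4) i) =
      ⟨rho (n := 4) i, hm⟩ := by
    rw [MulEquiv.symm_apply_eq]
    exact (toPerm_rho (n := 4) i).symm
  exact congrArg Subtype.val this

end SymmetricGroup

/-! ### Permutation action on the `λ_{ij}` -/

section Conjugates

/-- `x` is the conjugate of `λ_{12}` by a permutation that sends `1, 2` to `i, j`. -/
def IsLam (i j : Fin 4) (x : VB 4) : Prop :=
  ∃ w : Equiv.Perm (Fin 4), w 0 = i ∧ w 1 = j ∧
    x = permToVB w * (rho 0 * (sigma 0)⁻¹) * (permToVB w)⁻¹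

theorem isLam_conj {i j : Fin 4} {x : VB 4} (h : IsLam i j x) (k : Fin 3) :
    IsLam (transp (n := 4) k i) (transp (n := 4) k j) (rho k * x * rho k) := by
  obtain ⟨w, rfl, rfl, rfl⟩ := h
  refine ⟨transp (n := 4) k * w, rfl, rfl, ?_⟩
  rw [map_mul, permToVB_transp, mul_inv_rev, rho_inv]
  simp only [mul_assoc]

theorem isLam_lamVB {i j : Fin 4} (h : i ≠ j) : IsLam i j (lamVB i j) := by
  have b₀₁ : IsLam 0 1 (rho 0 * (sigma 0)⁻¹) := ⟨1, rfl, rfl, by simp⟩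
  have b₁₂ : IsLam 1 2 (rho 1 * (sigma 1)⁻¹) := by
    have := isLam_conj (isLam_conj b₀₁ 1) 0
    have e : rho 0 * (rho 1 * (rho 0 * (sigma 0)⁻¹) * rho 1) * rho 0 =
        (rho 1 * (sigma 1)⁻¹ : VB 4) :=
      conj_rho_mul_sigma_inv 0 1 rfl
    rw [e] at this
    exact this
  have b₂₃ : IsLam 2 3 (rho 2 * (sigma 2)⁻¹) := by
    have := isLam_conj (isLam_conj b₁₂ 2) 1
    have e : rho 1 * (rho 2 * (rho 1 * (sigma 1)⁻¹) * rho 2) * rho 1 =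
        (rho 2 * (sigma 2)⁻¹ : VB 4) :=
      conj_rho_mul_sigma_inv 1 2 rfl
    rw [e] at this
    exact this
  have flip (k : Fin 3) : rho k * (rho k * (sigma k)⁻¹) * rho k = ((sigma k)⁻¹ * rho k : VB 4) := by
    rw [rho_mul_self_mul]
  have b₁₀ := isLam_conj b₀₁ 0
  have b₂₁ := isLam_conj b₁₂ 1
  have b₃₂ := isLam_conj b₂₃ 2
  rw [flip] at b₁₀ b₂₁ b₃₂
  have b₀₂ := isLam_conj b₀₁ 1
  have b₂₀ := isLam_conj b₁₀ 1
  have b₁₃ := isLam_conj b₁₂ 2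
  have b₃₁ := isLam_conj b₂₁ 2
  have b₀₃ := isLam_conj b₀₂ 2
  have b₃₀ := isLam_conj b₂₀ 2
  fin_cases i <;> fin_cases j <;> first | exact absurd rfl h | assumption

/-- Every `λ_{ij}` is a conjugate of `λ₁₂`, and the choice of permutation is immaterial: the
pointwise stabilizer of `1, 2` is generated by the transposition `(3, 4)`, whose lift `ρ₃` commutes
with `λ₁₂`. So a relation needs to be checked for one choice of strands only. -/
theorem lamVB_perm {i j : Fin 4} (h : i ≠ j) (w : Equiv.Perm (Fin 4)) :
    lamVB (w i) (w j) = permToVB w * lamVB i j * (permToVB w)⁻¹ := by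
  obtain ⟨u, hu₀, hu₁, hu⟩ := isLam_lamVB h
  obtain ⟨v, hv₀, hv₁, hv⟩ := isLam_lamVB (w.injective.ne h)
  have stab : ∀ p : Equiv.Perm (Fin 4), p 0 = 0 → p 1 = 1 → p = 1 ∨ p = transp (n := 4) 2 := by
    decide +kernel
  have hc : Commute (permToVB ((w * u)⁻¹ * v)) (rho 0 * (sigma 0)⁻¹) := by
    rcases stab ((w * u)⁻¹ * v) (by simp [hv₀, ← hu₀])
      (by simp [hv₁, ← hu₁]) with e | e
    · rw [e, map_one]
      exact Commute.one_left _
    · rw [e, permToVB_transp]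
      exact Commute.mul_right (rho_comm 0 2 (by decide)).symm
        (Commute.inv_right (sigma_rho_comm 0 2 (by decide)).symm)
  have ev : permToVB v = permToVB w * permToVB u * permToVB ((w * u)⁻¹ * v) := by
    rw [← map_mul, ← map_mul, mul_inv_cancel_left]
  rw [hu, hv, ev]
  calc _ = permToVB w * permToVB u * (permToVB ((w * u)⁻¹ * v) * (rho 0 * (sigma 0)⁻¹)) *
        (permToVB ((w * u)⁻¹ * v))⁻¹ * (permToVB u)⁻¹ * (permToVB w)⁻¹ := by group
    _ = _ := by rw [hc.eq]; group

theorem isYB_lamVB : IsYB (lamVB (n := 4)) where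
  diag i := by simp [lamVB]
  comm i j k m h₁ h₂ h₃ h₄ h₅ h₆ := by
    have ex : ∀ i j k m : Fin 4, i ≠ j → i ≠ k → i ≠ m → j ≠ k → j ≠ m → k ≠ m →
        ∃ w : Equiv.Perm (Fin 4), w 0 = i ∧ w 1 = j ∧ w 2 = k ∧ w 3 = m := by decide +kernel
    obtain ⟨w, rfl, rfl, rfl, rfl⟩ := ex i j k m h₁ h₂ h₃ h₄ h₅ h₆
    rw [lamVB_perm (by decide), lamVB_perm (by decide), Commute.conj_iff]
    have e₁ : lamVB 0 1 = (rho 0 * (sigma 0)⁻¹ : VB 4) := rfl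
    have e₂ : lamVB 2 3 = (rho 2 * (sigma 2)⁻¹ : VB 4) := rfl
    rw [e₁, e₂]
    have c₁ : Commute (rho 0 : VB 4) (rho 2) := rho_comm 0 2 (by decide)
    have c₂ : Commute (sigma 0 : VB 4) (rho 2) := sigma_rho_comm 0 2 (by decide)
    have c₃ : Commute (sigma 2 : VB 4) (rho 0) := sigma_rho_comm 2 0 (by decide)
    have c₄ : Commute (sigma 0 : VB 4) (sigma 2) := sigma_comm 0 2 (by decide)
    exact (c₁.mul_left c₂.inv_left).mul_right (c₃.symm.inv_right.mul_left c₄.inv_inv)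
  yb k i j h₁ h₂ h₃ := by
    have ex : ∀ k i j : Fin 4, k ≠ i → k ≠ j → i ≠ j →
        ∃ w : Equiv.Perm (Fin 4), w 0 = k ∧ w 1 = i ∧ w 2 = j := by decide +kernel
    obtain ⟨w, rfl, rfl, rfl⟩ := ex k i j h₁ h₂ h₃
    rw [lamVB_perm (by decide), lamVB_perm (by decide), lamVB_perm (by decide)]
    have base : YBE (lamVB 0 1 : VB 4) (lamVB 0 2) (lamVB 1 2) := by
      have e₁ : lamVB 0 1 = (rho 0 * (sigma 0)⁻¹ : VB 4) := rfl
      have e₂ : lamVB 0 2 = (rho 1 * (rho 0 * (sigma 0)⁻¹) * rho 1 : VB 4) := rfl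
      have e₃ : lamVB 1 2 = (rho 1 * (sigma 1)⁻¹ : VB 4) := rfl
      rw [e₁, e₂, e₃]
      exact ybe_rho_sigma 0 1 rfl
    unfold YBE at *
    calc _ = permToVB w * (lamVB 0 1 * lamVB 0 2 * lamVB 1 2) * (permToVB w)⁻¹ := by group
      _ = _ := by rw [base]; group

end Conjugates

/-! ### Presentation of `VP_4` -/

section PureBraidPresentation

/-- The letter `λ_{ij}` as a word. -/
def lw {n : ℕ} (i j : Fin n) : FreeGroup (Fin n × Fin n) := FreeGroup.of (i, j)

/-- Relators of the virtual pure braid group. -/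
inductive VPRel (n : ℕ) : FreeGroup (Fin n × Fin n) → Prop
  | diag (i : Fin n) : VPRel n (lw i i)
  | comm (i j k m : Fin n) (h₁ : i ≠ j) (h₂ : i ≠ k) (h₃ : i ≠ m) (h₄ : j ≠ k) (h₅ : j ≠ m)
      (h₆ : k ≠ m) : VPRel n (lw i j * lw k m * (lw k m * lw i j)⁻¹)
  | yb (k i j : Fin n) (h₁ : k ≠ i) (h₂ : k ≠ j) (h₃ : i ≠ j) :
      VPRel n (lw k i * lw k j * lw i j * (lw i j * lw k j * lw k i)⁻¹)

/-- The group presented by the relations of the virtual pure braid group. -/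
abbrev PV (n : ℕ) : Type := PresentedGroup {r | VPRel n r}

/-- The generator `λ_{ij}`. -/
def PV.gen {n : ℕ} (i j : Fin n) : PV n := PresentedGroup.of (i, j)

theorem PV.isYB (n : ℕ) : IsYB (PV.gen (n := n)) where
  diag i := PresentedGroup.one_of_mem (VPRel.diag i)
  comm i j k m h₁ h₂ h₃ h₄ h₅ h₆ := by
    have := PresentedGroup.one_of_mem (rels := {r | VPRel n r})
      (VPRel.comm i j k m h₁ h₂ h₃ h₄ h₅ h₆)
    rwa [map_mul, map_inv, mul_inv_eq_one] at this
  yb k i j h₁ h₂ h₃ := by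
    have := PresentedGroup.one_of_mem (rels := {r | VPRel n r}) (VPRel.yb k i j h₁ h₂ h₃)
    rwa [map_mul, map_inv, mul_inv_eq_one] at this

variable {G : Type*} [Group G]

theorem IsYB.lift_eq_one {n : ℕ} {l : Fin n → Fin n → G} (h : IsYB l) :
    ∀ r ∈ {r | VPRel n r}, FreeGroup.lift (fun p : Fin n × Fin n => l p.1 p.2) r = 1 := by
  rintro r (⟨i⟩ | ⟨i, j, k, m, h₁, h₂, h₃, h₄, h₅, h₆⟩ | ⟨k, i, j, h₁, h₂, h₃⟩)
  · simpa [lw] using h.diag i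
  · rw [map_mul, map_inv, mul_inv_eq_one]
    simpa [lw] using (h.comm i j k m h₁ h₂ h₃ h₄ h₅ h₆).eq
  · rw [map_mul, map_inv, mul_inv_eq_one]
    simpa [lw, YBE] using h.yb k i j h₁ h₂ h₃

/-- The homomorphism to a group with a solution of the Yang–Baxter relations. -/
def PV.lift {n : ℕ} {l : Fin n → Fin n → G} (h : IsYB l) : PV n →* G :=
  PresentedGroup.toGroup h.lift_eq_one

theorem PV.lift_gen {n : ℕ} {l : Fin n → Fin n → G} (h : IsYB l) (i j : Fin n) :
    PV.lift h (PV.gen i j) = l i j :=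
  PresentedGroup.toGroup.of h.lift_eq_one

theorem PV.hom_ext {n : ℕ} {f g : PV n →* G}
    (h : ∀ i j, f (PV.gen i j) = g (PV.gen i j)) : f = g :=
  PresentedGroup.ext fun p => h p.1 p.2

theorem IsYB.perm {n : ℕ} {l : Fin n → Fin n → G} (h : IsYB l) (w : Equiv.Perm (Fin n)) :
    IsYB fun i j => l (w i) (w j) where
  diag i := h.diag _
  comm i j k m h₁ h₂ h₃ h₄ h₅ h₆ := by
    apply h.comm <;> rw [w.injective.ne_iff] <;> assumption
  yb k i j h₁ h₂ h₃ := by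
    apply h.yb <;> rw [w.injective.ne_iff] <;> assumption

/-- The symmetric group permutes the strands. -/
def PV.permHom {n : ℕ} (w : Equiv.Perm (Fin n)) : PV n →* PV n := PV.lift ((PV.isYB n).perm w)

theorem PV.permHom_gen {n : ℕ} (w : Equiv.Perm (Fin n)) (i j : Fin n) :
    PV.permHom w (PV.gen i j) = PV.gen (w i) (w j) := PV.lift_gen _ _ _

theorem PV.permHom_comp {n : ℕ} (v w : Equiv.Perm (Fin n)) :
    (PV.permHom v).comp (PV.permHom w) = PV.permHom (v * w) :=
  PV.hom_ext fun i j => by simp [PV.permHom_gen]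

theorem PV.permHom_one {n : ℕ} : PV.permHom (1 : Equiv.Perm (Fin n)) = MonoidHom.id _ :=
  PV.hom_ext fun i j => by simp [PV.permHom_gen]

/-- The action of the symmetric group by permutations of the strands. -/
def PV.act (n : ℕ) : Equiv.Perm (Fin n) →* MulAut (PV n) where
  toFun w := MonoidHom.toMulEquiv (PV.permHom w) (PV.permHom w⁻¹)
    (by rw [PV.permHom_comp, inv_mul_cancel, PV.permHom_one])
    (by rw [PV.permHom_comp, mul_inv_cancel, PV.permHom_one])
  map_one' := MulEquiv.ext fun x => DFunLike.congr_fun PV.permHom_one x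
  map_mul' v w := MulEquiv.ext fun x => (DFunLike.congr_fun (PV.permHom_comp v w) x).symm

theorem PV.act_gen {n : ℕ} (w : Equiv.Perm (Fin n)) (i j : Fin n) :
    PV.act n w (PV.gen i j) = PV.gen (w i) (w j) := PV.permHom_gen w i j

/-- The images of the generators of `VB_4` in the semidirect product. -/
def semidirectGen : VBGen 4 → PV 4 ⋊[PV.act 4] Equiv.Perm (Fin 4)
  | .sigma i => ⟨(PV.gen (n := 4) i.castSucc i.succ)⁻¹, transp (n := 4) i⟩
  | .rho i => ⟨1, transp (n := 4) i⟩

theorem lift_semidirectGen_eq_one (r : FreeGroup (VBGen 4)) (hr : r ∈ VBRels 4) :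
    FreeGroup.lift semidirectGen r = 1 := by
  obtain ⟨u, v, h, rfl⟩ := hr
  rw [map_mul, map_inv, mul_inv_eq_one]
  have hy := PV.isYB 4
  have key {i j : Fin 3} (h : i.val + 1 = j.val) :
      i = 0 ∧ j = 1 ∨ i = 1 ∧ j = 2 := by omega
  have key' {i j : Fin 3} (h : i.val + 1 < j.val) : i = 0 ∧ j = 2 := by omega
  have ybi (k i j : Fin 4) (h₁ : k ≠ i) (h₂ : k ≠ j) (h₃ : i ≠ j) :
      (PV.gen i j)⁻¹ * ((PV.gen k j)⁻¹ * (PV.gen k i)⁻¹) =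
        (PV.gen k i)⁻¹ * ((PV.gen k j)⁻¹ * (PV.gen i j)⁻¹) := by
    have := congrArg (·⁻¹) (hy.yb k i j h₁ h₂ h₃)
    simpa only [mul_inv_rev] using this
  have hc := (hy.comm 0 1 2 3 (by decide) (by decide) (by decide) (by decide) (by decide)
    (by decide)).inv_inv.eq
  cases h with
  | braid i j h =>
    simp only [sg, map_mul, FreeGroup.lift_apply_of, semidirectGen]
    refine SemidirectProduct.ext ?_ (transp_braid i j h)
    simp only [SemidirectProduct.mul_left, map_inv, PV.act_gen,
      mul_assoc]
    rcases key h with ⟨rfl, rfl⟩ | ⟨rfl, rfl⟩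
    · exact (ybi 0 1 2 (by decide) (by decide) (by decide)).symm
    · exact (ybi 1 2 3 (by decide) (by decide) (by decide)).symm
  | sigma_comm i j h =>
    simp only [sg, map_mul, FreeGroup.lift_apply_of, semidirectGen]
    refine SemidirectProduct.ext ?_ (transp_comm i j h)
    simp only [SemidirectProduct.mul_left, map_inv, PV.act_gen]
    obtain ⟨rfl, rfl⟩ := key' h
    exact hc
  | rho_sq i =>
    simp only [rh, map_mul, FreeGroup.lift_apply_of, semidirectGen]
    refine SemidirectProduct.ext ?_ (transp_mul_self (n := 4) i)
    simp
  | rho_braid i j h =>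
    simp only [rh, map_mul, FreeGroup.lift_apply_of, semidirectGen]
    refine SemidirectProduct.ext ?_ (transp_braid i j h)
    simp
  | rho_comm i j h =>
    simp only [rh, map_mul, FreeGroup.lift_apply_of, semidirectGen]
    refine SemidirectProduct.ext ?_ (transp_comm i j h)
    simp
  | mixed_comm i j h =>
    simp only [sg, rh, map_mul, FreeGroup.lift_apply_of, semidirectGen]
    refine SemidirectProduct.ext ?_ ?_
    · simp only [SemidirectProduct.mul_left, map_inv, map_one, mul_one, one_mul, PV.act_gen]
      rcases h with h | h <;> obtain ⟨rfl, rfl⟩ := key' h <;> rfl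
    · rcases h with h | h
      · exact transp_comm i j h
      · exact (transp_comm j i h).symm
  | mixed_braid i j h =>
    simp only [sg, rh, map_mul, FreeGroup.lift_apply_of, semidirectGen]
    refine SemidirectProduct.ext ?_ (transp_braid i j h)
    simp only [SemidirectProduct.mul_left, SemidirectProduct.mul_right, map_inv, map_one, mul_one,
      one_mul, PV.act_gen]
    rcases key h with ⟨rfl, rfl⟩ | ⟨rfl, rfl⟩ <;> rfl

/-- The homomorphism from `VB_4` to the semidirect product. -/
def toSemidirect : VB 4 →* PV 4 ⋊[PV.act 4] Equiv.Perm (Fin 4) :=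
  PresentedGroup.toGroup lift_semidirectGen_eq_one

theorem toSemidirect_rho (i : Fin 3) :
    toSemidirect (rho (n := 4) i) = SemidirectProduct.inr (transp (n := 4) i) :=
  PresentedGroup.toGroup.of lift_semidirectGen_eq_one

theorem toSemidirect_sigma (i : Fin 3) :
    toSemidirect (sigma (n := 4) i) = ⟨(PV.gen (n := 4) i.castSucc i.succ)⁻¹, transp (n := 4) i⟩ :=
  PresentedGroup.toGroup.of lift_semidirectGen_eq_one

theorem toSemidirect_permToVB (w : Equiv.Perm (Fin 4)) :
    toSemidirect (permToVB w) = SemidirectProduct.inr w := by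
  have key : ∀ x ∈ rhoSubgroup, toSemidirect x = SemidirectProduct.inr (toPerm 4 x) := by
    intro x hx
    have : rhoSubgroup ≤ MonoidHom.eqLocus toSemidirect (SemidirectProduct.inr.comp (toPerm 4)) := by
      rw [rhoSubgroup, Subgroup.closure_le]
      rintro _ ⟨i, rfl⟩
      exact (toSemidirect_rho i).trans (congrArg _ (toPerm_rho (n := 4) i).symm)
    exact this hx
  rw [key _ (permToVB_mem w), toPerm_permToVB]

theorem toSemidirect_lamVB (i j : Fin 4) :
    toSemidirect (lamVB i j) = SemidirectProduct.inl (PV.gen i j) := by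
  rcases eq_or_ne i j with rfl | h
  · rw [isYB_lamVB.diag, (PV.isYB 4).diag, map_one, map_one]
  · obtain ⟨w, rfl, rfl, hw⟩ := isLam_lamVB h
    have e : toSemidirect (rho (n := 4) (0 : Fin 3) * (sigma (n := 4) (0 : Fin 3))⁻¹) =
        SemidirectProduct.inl (PV.gen 0 1) := by
      rw [map_mul, map_inv, toSemidirect_rho, toSemidirect_sigma, mul_inv_eq_iff_eq_mul]
      ext
      · simp
      · simp
    rw [hw, map_mul, map_mul, map_inv, e, toSemidirect_permToVB, ← map_inv,
      ← SemidirectProduct.inl_aut,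
      PV.act_gen]

theorem isYB_lam : IsYB (lam (n := 4)) where
  diag i := Subtype.ext (isYB_lamVB.diag i)
  comm i j k m h₁ h₂ h₃ h₄ h₅ h₆ := Subtype.ext (isYB_lamVB.comm i j k m h₁ h₂ h₃ h₄ h₅ h₆)
  yb k i j h₁ h₂ h₃ := Subtype.ext (isYB_lamVB.yb k i j h₁ h₂ h₃)

/-- Injectivity holds because the map to the semidirect product restores the normal factor. For
surjectivity, the semidirect product maps back to `VB_4` so that the round trip from `VB_4` is the
identity, and a pure element has trivial permutation component. -/
theorem lift_lam_bijective : Function.Bijective (PV.lift isYB_lam) := by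
  have hval : (VP 4).subtype.comp (PV.lift isYB_lam) = PV.lift isYB_lamVB :=
    PV.hom_ext fun i j => by
      rw [MonoidHom.comp_apply, PV.lift_gen, PV.lift_gen]
      rfl
  constructor
  · have : toSemidirect.comp (PV.lift isYB_lamVB) = SemidirectProduct.inl :=
      PV.hom_ext fun i j => by rw [MonoidHom.comp_apply, PV.lift_gen, toSemidirect_lamVB]
    have hi : Function.Injective (toSemidirect.comp (PV.lift isYB_lamVB)) := by
      rw [this]
      exact SemidirectProduct.inl_injective
    rw [← hval] at hi
    exact Function.Injective.of_comp (f := fun x : VP 4 => toSemidirect x) hi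
  · have hact (w : Equiv.Perm (Fin 4)) : (PV.lift isYB_lamVB).comp (PV.act 4 w).toMonoidHom =
        (MulAut.conj (permToVB w)).toMonoidHom.comp (PV.lift isYB_lamVB) :=
      PV.hom_ext fun i j => by
        have e : (PV.act 4 w).toMonoidHom (PV.gen i j) = PV.gen (w i) (w j) := PV.act_gen w i j
        rw [MonoidHom.comp_apply, MonoidHom.comp_apply, e, PV.lift_gen, PV.lift_gen]
        rcases eq_or_ne i j with rfl | h
        · rw [isYB_lamVB.diag, isYB_lamVB.diag, map_one]
        · exact lamVB_perm h w
    have hid : (SemidirectProduct.lift (PV.lift isYB_lamVB) permToVB hact).comp toSemidirect =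
        MonoidHom.id (VB 4) := by
      apply PresentedGroup.ext
      intro x
      have hr (i : Fin 3) : (SemidirectProduct.lift (PV.lift isYB_lamVB) permToVB hact)
          (toSemidirect (rho (n := 4) i)) = rho (n := 4) i := by
        rw [toSemidirect_rho, SemidirectProduct.lift_inr, permToVB_transp]
      cases x with
      | rho i => exact hr i
      | sigma i =>
        change (SemidirectProduct.lift (PV.lift isYB_lamVB) permToVB hact)
          (toSemidirect (sigma (n := 4) i)) = sigma (n := 4) i
        have hl : lamVB (n := 4) (Fin.castSucc (n := 3) i) (Fin.succ (n := 3) i) =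
            rho (n := 4) i * (sigma (n := 4) i)⁻¹ := by
          change Fin 3 at i
          fin_cases i <;> rfl
        have e : sigma (n := 4) i = (lamVB (n := 4) (Fin.castSucc (n := 3) i) (Fin.succ (n := 3) i))⁻¹ *
            rho (n := 4) i := by
          rw [hl]
          group
        rw [e, map_mul, map_mul, hr, map_inv, map_inv, toSemidirect_lamVB,
          SemidirectProduct.lift_inl, PV.lift_gen]
    rintro ⟨x, hx⟩
    have h₁ := DFunLike.congr_fun hid x
    have h₂ : (toSemidirect x).right = 1 := by
      have : SemidirectProduct.rightHom.comp toSemidirect = toPerm 4 := by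
        apply PresentedGroup.ext
        intro y
        have e : toPerm 4 (PresentedGroup.of y) = genPerm y :=
          PresentedGroup.toGroup.of lift_genPerm_eq_one
        have e' : toSemidirect (PresentedGroup.of y) = semidirectGen y :=
          PresentedGroup.toGroup.of lift_semidirectGen_eq_one
        rw [MonoidHom.comp_apply, e, e']
        cases y <;> rfl
      exact (DFunLike.congr_fun this x).trans hx
    refine ⟨(toSemidirect x).left, Subtype.ext ?_⟩
    have e : toSemidirect x = SemidirectProduct.inl (toSemidirect x).left :=
      SemidirectProduct.ext rfl h₂
    rw [MonoidHom.comp_apply, e, SemidirectProduct.lift_inl, ← hval] at h₁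
    exact h₁

/-- The presentation of the virtual pure braid group on four strands. -/
noncomputable def presentVP : PV 4 ≃* VP 4 := MulEquiv.ofBijective _ lift_lam_bijective

theorem VP.exists_lift {l : Fin 4 → Fin 4 → G} (h : IsYB l) :
    ∃ f : VP 4 →* G, ∀ i j, f (lam i j) = l i j := by
  refine ⟨(PV.lift h).comp presentVP.symm.toMonoidHom, fun i j => ?_⟩
  have : presentVP.symm (lam i j) = PV.gen i j := by
    rw [MulEquiv.symm_apply_eq]
    exact (PV.lift_gen isYB_lam i j).symm
  exact (congrArg (PV.lift h) this).trans (PV.lift_gen h i j)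

theorem VP.hom_ext {f g : VP 4 →* G} (h : ∀ i j, f (lam i j) = g (lam i j)) : f = g := by
  have : f.comp presentVP.toMonoidHom = g.comp presentVP.toMonoidHom :=
    PV.hom_ext fun i j => by
      have e : presentVP.toMonoidHom (PV.gen i j) = lam i j := PV.lift_gen isYB_lam i j
      rw [MonoidHom.comp_apply, MonoidHom.comp_apply, e, h]
  ext x
  obtain ⟨y, rfl⟩ := presentVP.surjective x
  exact DFunLike.congr_fun this y

end PureBraidPresentation

/-! ### Freeness of `A` via the holomorph of a free group -/

section FreeRepresentation

variable {ι : Type*}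

/-- The free generators `x_i`. -/
def fx (i : ι) : FreeGroup (ι ⊕ ι) := FreeGroup.of (Sum.inl i)

/-- The free generators `y_i`. -/
def fy (i : ι) : FreeGroup (ι ⊕ ι) := FreeGroup.of (Sum.inr i)

theorem free_hom_ext {G : Type*} [Group G] {f g : FreeGroup (ι ⊕ ι) →* G}
    (hx : ∀ k, f (fx k) = g (fx k)) (hy : ∀ k, f (fy k) = g (fy k)) : f = g := by
  apply FreeGroup.ext_hom
  rintro (k | k)
  · exact hx k
  · exact hy k

/-- The holomorph of the free group. -/
abbrev Hol (ι : Type*) : Type _ :=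
  FreeGroup (ι ⊕ ι) ⋊[MonoidHom.id (MulAut (FreeGroup (ι ⊕ ι)))] MulAut (FreeGroup (ι ⊕ ι))

theorem inr_inv_mul_inl (g : MulAut (FreeGroup (ι ⊕ ι))) (x : FreeGroup (ι ⊕ ι)) :
    (SemidirectProduct.inr g⁻¹ * SemidirectProduct.inl (g x) : Hol ι) =
      SemidirectProduct.inl x * SemidirectProduct.inr g⁻¹ := by
  ext <;> simp

variable [DecidableEq ι]

/-- An automorphism of the free group by which `λ_{ij}` acts. -/
def theta (i j : ι) : FreeGroup (ι ⊕ ι) →* FreeGroup (ι ⊕ ι) :=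
  FreeGroup.lift (Sum.elim
    (fun k => if k = i then fy j * fx i * (fy j)⁻¹
      else if k = j then fx i * fx j * fy j * (fx i)⁻¹ * (fy j)⁻¹ else fx k)
    (fun k => if k = i then fy j * fy i * (fy j)⁻¹ else fy k))

/-- The inverse of `theta i j`. -/
def thetaInv (i j : ι) : FreeGroup (ι ⊕ ι) →* FreeGroup (ι ⊕ ι) :=
  FreeGroup.lift (Sum.elim
    (fun k => if k = i then (fy j)⁻¹ * fx i * fy j
      else if k = j then (fy j)⁻¹ * (fx i)⁻¹ * fy j * fx j * fx i else fx k)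
    (fun k => if k = i then (fy j)⁻¹ * fy i * fy j else fy k))

/-- With `λ_{i4}` acting as `x_i` and `λ_{4j}` as `y_j`, the Yang–Baxter relations through strand
`4` force these formulas once `y_j` is chosen to be fixed: `y_i y_j ↦ y_j y_i`, `x_j x_i ↦ x_i x_j`,
`y_j⁻¹ x_i y_j ↦ x_i`. -/
theorem theta_fx (i j k : ι) : theta i j (fx k) = if k = i then fy j * fx i * (fy j)⁻¹
      else if k = j then fx i * fx j * fy j * (fx i)⁻¹ * (fy j)⁻¹ else fx k := by
  simp [theta, fx]

theorem theta_fy (i j k : ι) :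
    theta i j (fy k) = if k = i then fy j * fy i * (fy j)⁻¹ else fy k := by
  simp [theta, fy]

theorem thetaInv_fx (i j k : ι) : thetaInv i j (fx k) = if k = i then (fy j)⁻¹ * fx i * fy j
      else if k = j then (fy j)⁻¹ * (fx i)⁻¹ * fy j * fx j * fx i else fx k := by
  simp [thetaInv, fx]

theorem thetaInv_fy (i j k : ι) :
    thetaInv i j (fy k) = if k = i then (fy j)⁻¹ * fy i * fy j else fy k := by
  simp [thetaInv, fy]

theorem theta_comp_thetaInv {i j : ι} (h : i ≠ j) :
    (theta i j).comp (thetaInv i j) = MonoidHom.id _ := by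
  apply free_hom_ext <;> intro k
  · rcases eq_or_ne k i with rfl | hi
    · simp [thetaInv_fx, theta_fx, theta_fy, h.symm]
      try group
    · rcases eq_or_ne k j with rfl | hj
      · simp [thetaInv_fx, theta_fx, theta_fy, hi]
        try group
      · simp [thetaInv_fx, theta_fx, hi, hj]
  · rcases eq_or_ne k i with rfl | hi
    · simp [thetaInv_fy, theta_fy, h.symm]
      try group
    · simp [thetaInv_fy, theta_fy, hi]

theorem thetaInv_comp_theta {i j : ι} (h : i ≠ j) :
    (thetaInv i j).comp (theta i j) = MonoidHom.id _ := by
  apply free_hom_ext <;> intro k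
  · rcases eq_or_ne k i with rfl | hi
    · simp [thetaInv_fx, theta_fx, thetaInv_fy, h.symm]
      try group
    · rcases eq_or_ne k j with rfl | hj
      · simp [thetaInv_fx, theta_fx, thetaInv_fy, hi]
        try group
      · simp [thetaInv_fx, theta_fx, hi, hj]
  · rcases eq_or_ne k i with rfl | hi
    · simp [thetaInv_fy, theta_fy, h.symm]
      try group
    · simp [thetaInv_fy, theta_fy, hi]

/-- The relation on strands `1, 2, 3`. The order is reversed because `λ_{ij}` is represented by the
inverse automorphism. -/
theorem theta_ybe {k i j : ι} (h₁ : k ≠ i) (h₂ : k ≠ j) (h₃ : i ≠ j) :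
    (theta i j).comp ((theta k j).comp (theta k i)) =
      (theta k i).comp ((theta k j).comp (theta i j)) := by
  apply free_hom_ext <;> intro m
  · rcases eq_or_ne m k with rfl | hk
    · simp [theta_fx, theta_fy, h₁, h₂, h₁.symm, h₂.symm, h₃.symm]
      try group
    · rcases eq_or_ne m i with rfl | hi
      · simp [theta_fx, theta_fy, h₁, h₂, h₃, h₁.symm, h₂.symm, h₃.symm]
        try group
      · rcases eq_or_ne m j with rfl | hj
        · simp [theta_fx, theta_fy, h₁, h₂, h₃, h₁.symm, h₂.symm, h₃.symm]
          try group
        · simp [theta_fx, hk, hi, hj]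
  · rcases eq_or_ne m k with rfl | hk
    · simp [theta_fy, h₁, h₁.symm, h₂.symm, h₃.symm]
      try group
    · rcases eq_or_ne m i with rfl | hi
      · simp [theta_fy, h₁.symm, h₂.symm]
        try group
      · simp [theta_fy, hk, hi]

/-- `theta i j` as an automorphism. -/
def thetaAut {i j : ι} (h : i ≠ j) : MulAut (FreeGroup (ι ⊕ ι)) :=
  MonoidHom.toMulEquiv (theta i j) (thetaInv i j) (thetaInv_comp_theta h) (theta_comp_thetaInv h)

theorem thetaAut_apply {i j : ι} (h : i ≠ j) (x : FreeGroup (ι ⊕ ι)) :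
    thetaAut h x = theta i j x := rfl

/-- The images of the `λ_{ij}` in the holomorph of a free group. -/
def holGen (i j : Fin 4) : Hol (Fin 4) :=
  if h : i = j then 1
  else if j = 3 then SemidirectProduct.inl (fx i)
  else if i = 3 then SemidirectProduct.inl (fy j)
  else SemidirectProduct.inr (thetaAut h)⁻¹

theorem holGen_last {i : Fin 4} (h : i ≠ 3) : holGen i 3 = SemidirectProduct.inl (fx i) := by
  simp [holGen, h]

theorem holGen_first {j : Fin 4} (h : j ≠ 3) : holGen 3 j = SemidirectProduct.inl (fy j) := by
  simp [holGen, h, h.symm]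

theorem holGen_of_ne {i j : Fin 4} (h : i ≠ j) (hi : i ≠ 3) (hj : j ≠ 3) :
    holGen i j = SemidirectProduct.inr (thetaAut h)⁻¹ := by
  simp [holGen, h, hi, hj]

theorem commute_inl_holGen {i j : Fin 4} (h : i ≠ j) (hi : i ≠ 3) (hj : j ≠ 3)
    {x : FreeGroup (Fin 4 ⊕ Fin 4)} (hx : theta i j x = x) :
    Commute (SemidirectProduct.inl x) (holGen i j) := by
  have := inr_inv_mul_inl (thetaAut h) x
  rw [thetaAut_apply, hx] at this
  rw [holGen_of_ne h hi hj]
  exact this.symm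

theorem isYB_holGen : IsYB holGen where
  diag i := by simp [holGen]
  comm i j k m h₁ h₂ h₃ h₄ h₅ h₆ := by
    -- Four distinct indices exhaust the strands, so one of the two commuting elements is a free
    -- generator and the other an automorphism fixing it.
    have cases4 : i = 3 ∨ j = 3 ∨ k = 3 ∨ m = 3 := by omega
    rcases cases4 with rfl | rfl | rfl | rfl
    · rw [holGen_first h₁.symm]
      refine commute_inl_holGen h₆ h₂.symm h₃.symm ?_
      simp [theta_fy, h₄]
    · rw [holGen_last h₁]
      refine commute_inl_holGen h₆ h₄.symm h₅.symm ?_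
      simp [theta_fx, h₂, h₃]
    · rw [holGen_first h₆.symm]
      refine (commute_inl_holGen h₁ h₂ h₄ ?_).symm
      simp [theta_fy, h₃.symm]
    · rw [holGen_last h₆]
      refine (commute_inl_holGen h₁ h₃ h₅ ?_).symm
      simp [theta_fx, h₂.symm, h₄.symm]
  yb k i j h₁ h₂ h₃ := by
    unfold YBE
    by_cases hk : k = 3
    · subst hk
      have := inr_inv_mul_inl (thetaAut h₃) (fy i * fy j)
      have e : thetaAut h₃ (fy i * fy j) = fy j * fy i := by
        simp [thetaAut_apply, theta_fy, h₃.symm]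
      rw [e, map_mul, map_mul, ← mul_assoc] at this
      rw [holGen_first h₁.symm, holGen_first h₂.symm, holGen_of_ne h₃ h₁.symm h₂.symm, this]
    by_cases hi : i = 3
    · subst hi
      have e₁ := inr_inv_mul_inl (thetaAut h₂) (fy j)
      have e₂ := inr_inv_mul_inl (thetaAut h₂) ((fy j)⁻¹ * fx k * fy j)
      rw [thetaAut_apply, theta_fy, if_neg h₂.symm] at e₁
      have e : thetaAut h₂ ((fy j)⁻¹ * fx k * fy j) = fx k := by
        simp [thetaAut_apply, theta_fx, theta_fy, h₂.symm, mul_assoc]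
      rw [e] at e₂
      rw [holGen_last h₁, holGen_first h₃.symm, holGen_of_ne h₂ h₁ h₃.symm, mul_assoc, e₁,
        mul_assoc, e₂, ← mul_assoc, ← mul_assoc, ← map_mul, ← map_mul]
      congr 2
      group
    by_cases hj : j = 3
    · subst hj
      have := inr_inv_mul_inl (thetaAut h₁) (fx i * fx k)
      have e : thetaAut h₁ (fx i * fx k) = fx k * fx i := by
        simp [thetaAut_apply, theta_fx, h₁.symm, mul_assoc]
      rw [e, map_mul, map_mul, ← mul_assoc] at this
      rw [holGen_last h₂, holGen_last h₃, holGen_of_ne h₁ h₂ h₃, this]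
    rw [holGen_of_ne h₁ hk hi, holGen_of_ne h₂ hk hj, holGen_of_ne h₃ hi hj]
    simp only [← map_mul, ← mul_inv_rev]
    congr 2
    ext x
    exact DFunLike.congr_fun (theta_ybe h₁ h₂ h₃) x

/-- The generators of `A` are free. -/
theorem lift_lam_injective : Function.Injective (FreeGroup.lift
    (![lam 2 3, lam 1 3, lam 0 3, lam 3 2, lam 3 1, lam 3 0] : Fin 6 → VP 4)) := by
  obtain ⟨ψ, hψ⟩ := VP.exists_lift isYB_holGen
  let e : Fin 6 → Fin 4 ⊕ Fin 4 :=
    ![Sum.inl 2, Sum.inl 1, Sum.inl 0, Sum.inr 2, Sum.inr 1, Sum.inr 0]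
  have he : Function.Injective e := by decide
  have : ψ.comp (FreeGroup.lift
      (![lam 2 3, lam 1 3, lam 0 3, lam 3 2, lam 3 1, lam 3 0] : Fin 6 → VP 4)) =
      SemidirectProduct.inl.comp (FreeGroup.map e) := by
    apply FreeGroup.ext_hom
    intro i
    fin_cases i <;> simp [hψ, e, holGen_last, holGen_first, fx, fy]
  have hi : Function.Injective (ψ.comp (FreeGroup.lift
      (![lam 2 3, lam 1 3, lam 0 3, lam 3 2, lam 3 1, lam 3 0] : Fin 6 → VP 4))) := by
    rw [this]
    exact SemidirectProduct.inl_injective.comp (FreeGroup.map_injective he)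
  exact Function.Injective.of_comp (f := ψ) hi

end FreeRepresentation

/-! ### Naturality of the words and relations -/

section Naturality

variable {G H : Type*} [Group G] [Group H]

theorem map_aWord (φ : G →* H) (f : Gen → G) (i : Fin 6) :
    φ (aWord f i) = aWord (fun x => φ (f x)) i := by
  fin_cases i <;> simp [aWord, genB21, genB12]

theorem map_bWord (φ : G →* H) (f : Gen → G) (i : Fin 6) :
    φ (bWord f i) = bWord (fun x => φ (f x)) i := by
  fin_cases i <;> simp [bWord, map_cj, map_aWord]

theorem map_lamOf (φ : G →* H) (f : Gen → G) (t : G) (i j : Fin 4) :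
    φ (lamOf f t i j) = lamOf (fun x => φ (f x)) (φ t) i j := by
  fin_cases i <;> fin_cases j <;> simp [lamOf, map_aWord, genB21, genB12]

theorem map_cabledGen (φ : G →* H) (l : Fin 4 → Fin 4 → G) (x : Gen) :
    φ (cabledGen l x) = cabledGen (fun i j => φ (l i j)) x := by
  cases x <;> simp [cabledGen]

theorem map_lift (φ : G →* H) (f : Gen → G) (r : FreeGroup Gen) :
    φ (FreeGroup.lift f r) = FreeGroup.lift (fun x => φ (f x)) r := by
  have : φ.comp (FreeGroup.lift f) = FreeGroup.lift fun x => φ (f x) :=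
    FreeGroup.ext_hom _ _ fun x => by simp
  exact DFunLike.congr_fun this r

theorem BaseRel.map {f : Gen → G} (h : BaseRel f) (φ : G →* H) : BaseRel fun x => φ (f x) :=
  lift_rels_iff_baseRel.1 fun r hr => by
    rw [← map_lift, lift_rels_iff_baseRel.2 h r hr, map_one]

theorem BaseRel.of_injective {f : Gen → G} {φ : G →* H} (hφ : Function.Injective φ)
    (h : BaseRel fun x => φ (f x)) : BaseRel f :=
  lift_rels_iff_baseRel.1 fun r hr => by
    apply hφ
    rw [map_lift, lift_rels_iff_baseRel.2 h r hr, map_one]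

theorem lamOf_cabledGen {l : Fin 4 → Fin 4 → G} (h : ∀ i, l i i = 1) :
    lamOf (cabledGen l) (l 0 1) = l := by
  funext i j
  fin_cases i <;> fin_cases j <;>
    simp [lamOf, cabledGen, aWord, genB21, genB12, mul_assoc, h]

theorem aWord_cabledGen {l : Fin 4 → Fin 4 → G} (h : ∀ i, l i i = 1) :
    aWord (cabledGen l) = ![l 2 3, l 1 3, l 0 3, l 3 2, l 3 1, l 3 0] := by
  have e (i j : Fin 4) := congrFun (congrFun (lamOf_cabledGen h) i) j
  funext i
  fin_cases i
  exacts [e 2 3, e 1 3, e 0 3, e 3 2, e 3 1, e 3 0]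

theorem IsYB.aWord_mul {l : Fin 4 → Fin 4 → G} (h : IsYB l) (i : Fin 6) :
    aWord (cabledGen l) i * l 0 1 = l 0 1 * bWord (cabledGen l) i := by
  have hc := h.disjointComm
  have e₁ : cabledGen l .a12 * (l 0 1)⁻¹ = l 0 2 := by simp [cabledGen]
  have e₂ : (cabledGen l .a21)⁻¹ * cabledGen l .a12 * (l 0 1)⁻¹ = (l 1 2)⁻¹ := by
    simp [cabledGen, mul_assoc]
  simp only [bWord, aWord_cabledGen h.diag]
  fin_cases i
  · exact hc.c₁₂₃₄.eq.symm
  · exact mul_eq_mul_cj (e₁ ▸ hc.c₁₃₂₄)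
  · exact mul_eq_mul_cj (e₂ ▸ hc.c₂₃₁₄.inv_left)
  · exact hc.c₁₂₄₃.eq.symm
  · exact mul_eq_mul_cj (e₁ ▸ hc.c₁₃₄₂)
  · exact mul_eq_mul_cj (e₂ ▸ hc.c₂₃₄₁.inv_left)

end Naturality

/-! ### The base group and the HNN-extension -/

theorem genVal_eq : genVal = cabledGen lam := by
  funext x
  cases x <;> rfl

theorem baseRel_genVal : BaseRel genVal := genVal_eq ▸ isYB_lam.baseRel

theorem aWord_genVal :
    aWord genVal = ![lam 2 3, lam 1 3, lam 0 3, lam 3 2, lam 3 1, lam 3 0] := by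
  rw [genVal_eq, aWord_cabledGen isYB_lam.diag]

theorem aWord_genVal_mul (i : Fin 6) :
    aWord genVal i * a11 = a11 * bWord genVal i := by
  rw [genVal_eq]
  exact isYB_lam.aWord_mul i

theorem A_eq_closure : A = Subgroup.closure (Set.range (aWord genVal)) := by
  rw [aWord_genVal, A]
  congr 1
  simp only [Matrix.range_cons, Matrix.range_empty, Set.union_empty, Set.singleton_union]
  rfl

theorem BWords_eq_closure : BWords = Subgroup.closure (Set.range (bWord genVal)) := by
  have e₁ : genB21 genVal = b21 := mul_inv_cancel_right _ _
  have e₂ : genB12 genVal = b12 := mul_inv_cancel_right _ _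
  rw [BWords]
  congr 1
  simp only [bWord, Matrix.range_cons, Matrix.range_empty, Set.union_empty, Set.singleton_union,
    aWord, e₁, e₂]
  rfl

theorem B_eq_closure : B = Subgroup.closure (Set.range (bWord genVal)) := by
  rw [B, A_eq_closure, MonoidHom.map_closure, ← Set.range_comp]
  congr 2
  funext i
  have := aWord_genVal_mul i
  simp only [Function.comp_apply, MulEquiv.coe_toMonoidHom, MulAut.conj_apply, inv_inv]
  rw [mul_assoc, this, inv_mul_cancel_left]

theorem genVal_mem (x : Gen) : genVal x ∈ G4 := Subgroup.subset_closure ⟨x, rfl⟩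

/-- The generators of the base group in the base group. -/
def genG4 (x : Gen) : G4 := ⟨genVal x, genVal_mem x⟩

theorem closure_genG4 : Subgroup.closure (Set.range genG4) = ⊤ := by
  refine Eq.trans (congrArg Subgroup.closure ?_)
    (Subgroup.closure_closure_coe_preimage (k := Set.range genVal))
  ext ⟨y, hy⟩
  constructor
  · rintro ⟨x, hx⟩
    exact ⟨x, congrArg Subtype.val hx⟩
  · rintro ⟨x, hx⟩
    exact ⟨x, Subtype.ext hx⟩

theorem baseRel_genG4 : BaseRel genG4 :=
  BaseRel.of_injective (φ := G4.subtype) Subtype.val_injective baseRel_genVal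

theorem A_le : A ≤ G4 := by
  rw [A_eq_closure, Subgroup.closure_le]
  rintro _ ⟨i, rfl⟩
  exact map_aWord G4.subtype genG4 i ▸ (aWord genG4 i).2

theorem B_le : B ≤ G4 := by
  rw [B_eq_closure, Subgroup.closure_le]
  rintro _ ⟨i, rfl⟩
  exact map_bWord G4.subtype genG4 i ▸ (bWord genG4 i).2

/-- A group that is generated by elements with the relations of the base group and that maps to
`VP_4` has an HNN-extension isomorphic to `VP_4`. -/
theorem exists_hnn_equiv {Q : Type*} [Group Q] {f : Gen → Q}
    (hcl : Subgroup.closure (Set.range f) = ⊤) (hf : BaseRel f) (i : Q →* VP 4)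
    (hi : ∀ x, i (f x) = genVal x) {A' B' : Subgroup Q} (φ : B' ≃* A')
    (hφ : ∀ k, ∃ h : bWord f k ∈ B', (φ ⟨bWord f k, h⟩ : Q) = aWord f k)
    (hc : ∀ b : B', a11 * i b = i (φ b) * a11) :
    ∃ e : HNNExtension Q B' A' φ ≃* VP 4, (∀ g, e (HNNExtension.of g) = i g) ∧
      e HNNExtension.t = a11 := by
  -- The relations of `VP_4` hold in the HNN-extension, which provides the inverse homomorphism.
  -- Both composites are then checked on generators.
  have hy : IsYB (lamOf (fun x => (HNNExtension.of (f x) : HNNExtension Q B' A' φ))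
      HNNExtension.t) := by
    refine (hf.map HNNExtension.of).isYB fun k => ?_
    obtain ⟨h, hk⟩ := hφ k
    rw [← map_aWord, ← map_bWord, ← hk]
    exact (HNNExtension.t_mul_of (⟨bWord f k, h⟩ : B')).symm
  obtain ⟨g, hg⟩ := VP.exists_lift hy
  have hgen (x : Gen) : g (genVal x) = HNNExtension.of (f x) := by
    rw [genVal_eq, map_cabledGen]
    simp only [hg]
    exact congrFun (cabledGen_lamOf _ _) x
  have hil : (fun x => i (f x)) = cabledGen lam := (funext hi).trans genVal_eq
  have hgF : g.comp (HNNExtension.lift i a11 hc) = MonoidHom.id _ := by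
    refine HNNExtension.hom_ext (MonoidHom.eq_of_eqOn_dense hcl ?_) ?_
    · rintro _ ⟨x, rfl⟩
      simp [hi, hgen]
    · simp only [MonoidHom.comp_apply, HNNExtension.lift_t, MonoidHom.id_apply]
      exact hg 0 1
  have hFg : (HNNExtension.lift i a11 hc).comp g = MonoidHom.id _ := by
    refine VP.hom_ext fun k m => ?_
    rw [MonoidHom.comp_apply, hg, map_lamOf]
    simp only [HNNExtension.lift_of, HNNExtension.lift_t, hil]
    exact congrFun (congrFun (lamOf_cabledGen isYB_lam.diag) k) m
  exact ⟨MonoidHom.toMulEquiv _ g hgF hFg, HNNExtension.lift_of i a11 hc,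
    HNNExtension.lift_t i a11 hc⟩

/-- The homomorphism to `VP_4` from the group presented by the relations of the base group. -/
def presentedToVP : PresentedGroup G4Rels →* VP 4 :=
  PresentedGroup.toGroup (lift_rels_iff_baseRel.2 baseRel_genVal)

theorem presentedToVP_of (x : Gen) : presentedToVP (PresentedGroup.of x) = genVal x :=
  PresentedGroup.toGroup.of _

/-- An HNN-extension over the presented group is isomorphic to `VP_4` in a way that extends this
homomorphism, and the base of an HNN-extension embeds. -/
theorem presentedToVP_injective : Function.Injective presentedToVP := by
  have hf : BaseRel fun x => (PresentedGroup.of x : PresentedGroup G4Rels) := by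
    refine lift_rels_iff_baseRel.1 fun r hr => ?_
    have : FreeGroup.lift (fun x => (PresentedGroup.of x : PresentedGroup G4Rels)) =
        PresentedGroup.mk G4Rels := FreeGroup.ext_hom _ _ fun x => by simp [PresentedGroup.of]
    rw [this]
    exact PresentedGroup.one_of_mem hr
  let α := FreeGroup.lift (aWord fun x => (PresentedGroup.of x : PresentedGroup G4Rels))
  let β := FreeGroup.lift (bWord fun x => (PresentedGroup.of x : PresentedGroup G4Rels))
  have hα : presentedToVP.comp α = FreeGroup.lift (aWord genVal) :=
    FreeGroup.ext_hom _ _ fun k => by simp [α, map_aWord, presentedToVP_of]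
  -- In `VP_4` the words for `B`, conjugated back by `a₁₁`, become the free generators of `A`. Hence
  -- both sextuples are free in the presented group, and matching them defines the isomorphism `φ`.
  have hβ : (MulAut.conj a11).toMonoidHom.comp (presentedToVP.comp β) =
      FreeGroup.lift (aWord genVal) :=
    FreeGroup.ext_hom _ _ fun k => by
      simp [β, map_bWord, presentedToVP_of, ← aWord_genVal_mul]
  have inj : Function.Injective (FreeGroup.lift (aWord genVal)) :=
    aWord_genVal ▸ lift_lam_injective
  have iα : Function.Injective α := by
    rw [← hα] at inj
    exact Function.Injective.of_comp inj
  have iβ : Function.Injective β := by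
    rw [← hβ] at inj
    exact Function.Injective.of_comp (f := fun x => MulAut.conj a11 (presentedToVP x)) inj
  let φ : β.range ≃* α.range := (MonoidHom.ofInjective iβ).symm.trans (MonoidHom.ofInjective iα)
  have hφ (w : FreeGroup (Fin 6)) : φ ⟨β w, w, rfl⟩ = ⟨α w, w, rfl⟩ := by
    have : (MonoidHom.ofInjective iβ).symm ⟨β w, w, rfl⟩ = w :=
      (MonoidHom.ofInjective iβ).symm_apply_apply w
    simp only [φ, MulEquiv.trans_apply, this]
    rfl
  obtain ⟨e, he, -⟩ := exists_hnn_equiv (PresentedGroup.closure_range_of G4Rels) hf presentedToVP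
    presentedToVP_of φ
    (fun k => ⟨⟨FreeGroup.of k, FreeGroup.lift_apply_of⟩, by
      have := congrArg Subtype.val (hφ (FreeGroup.of k))
      simpa [α, β] using this⟩)
    (by
      rintro ⟨_, w, rfl⟩
      rw [hφ]
      have h₁ := DFunLike.congr_fun hα w
      have h₂ := DFunLike.congr_fun hβ w
      rw [← h₁] at h₂
      exact mul_inv_eq_iff_eq_mul.1 h₂)
  have : ⇑presentedToVP = e ∘ HNNExtension.of := funext fun g => (he g).symm
  rw [this]
  exact e.injective.comp (HNNExtension.of_injective _)

theorem range_presentedToVP : presentedToVP.range = G4 := by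
  rw [MonoidHom.range_eq_map, ← PresentedGroup.closure_range_of, MonoidHom.map_closure,
    ← Set.range_comp, G4]
  congr 2
  funext x
  exact presentedToVP_of x

end VirtualBraid

open VirtualBraid

theorem theorem4p11 :
    -- the base group is defined by the listed relations
    (∃ e : PresentedGroup VirtualBraid.G4Rels ≃* VirtualBraid.G4,
      ∀ x : VirtualBraid.Gen,
        ((e (PresentedGroup.of x) : VirtualBraid.G4) : VirtualBraid.VP 4) =
          VirtualBraid.genVal x) ∧
    -- the associated subgroups lie in the base group; `B` in terms of the generators
    VirtualBraid.A ≤ VirtualBraid.G4 ∧ VirtualBraid.B ≤ VirtualBraid.G4 ∧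
    VirtualBraid.B = VirtualBraid.BWords ∧
    -- the extension: the stable letter `t` is `a₁₁`, and `a₁₁⁻¹ x a₁₁ = φ x` for `x` in `A`
    ∃ φ : VirtualBraid.A.subgroupOf VirtualBraid.G4 ≃*
        VirtualBraid.B.subgroupOf VirtualBraid.G4,
      (∀ x : VirtualBraid.A.subgroupOf VirtualBraid.G4,
        (((φ x : VirtualBraid.G4)) : VirtualBraid.VP 4) =
          VirtualBraid.cj ((x : VirtualBraid.G4) : VirtualBraid.VP 4) VirtualBraid.a11) ∧
      ∃ f : HNNExtension VirtualBraid.G4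
            (VirtualBraid.B.subgroupOf VirtualBraid.G4)
            (VirtualBraid.A.subgroupOf VirtualBraid.G4) φ.symm ≃* VirtualBraid.VP 4,
        (∀ g : VirtualBraid.G4, f (HNNExtension.of g) = (g : VirtualBraid.VP 4)) ∧
        f HNNExtension.t = VirtualBraid.a11 := by
  refine ⟨⟨(MonoidHom.ofInjective presentedToVP_injective).trans
      (MulEquiv.subgroupCongr range_presentedToVP), presentedToVP_of⟩, A_le, B_le,
    B_eq_closure.trans BWords_eq_closure.symm, ?_⟩
  let φ : A.subgroupOf G4 ≃* B.subgroupOf G4 := (Subgroup.subgroupOfEquivOfLe A_le).trans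
    ((A.equivMapOfInjective _ (MulAut.conj a11⁻¹).injective).trans
      (Subgroup.subgroupOfEquivOfLe B_le).symm)
  have hφ (x : A.subgroupOf G4) : ((φ x : G4) : VP 4) = cj ((x : G4) : VP 4) a11 := by
    have : ((φ x : G4) : VP 4) = a11⁻¹ * ((x : G4) : VP 4) * a11⁻¹⁻¹ := rfl
    rw [this, inv_inv, cj]
  -- In `HNNExtension` the stable letter satisfies `t * b = φ.symm b * t`, so the conjugation `x ↦ x
  -- ^ a₁₁` from `A` to `B` enters through its inverse.
  refine ⟨φ, hφ, exists_hnn_equiv closure_genG4 baseRel_genG4 G4.subtype (fun _ => rfl) φ.symm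
    (fun k => ?_) (fun b => ?_)⟩
  · have ha : aWord genG4 k ∈ A.subgroupOf G4 := by
      rw [Subgroup.mem_subgroupOf, A_eq_closure]
      exact Subgroup.subset_closure ⟨k, (map_aWord G4.subtype genG4 k).symm⟩
    have e : (φ ⟨_, ha⟩ : G4) = bWord genG4 k := by
      apply Subtype.ext
      rw [hφ]
      have h₁ : ((aWord genG4 k : G4) : VP 4) = aWord genVal k := map_aWord G4.subtype genG4 k
      have h₂ : ((bWord genG4 k : G4) : VP 4) = bWord genVal k := map_bWord G4.subtype genG4 k
      change cj ((aWord genG4 k : G4) : VP 4) a11 = _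
      rw [h₁, h₂, cj, mul_assoc, aWord_genVal_mul, inv_mul_cancel_left]
    refine ⟨e ▸ (φ ⟨_, ha⟩).2, ?_⟩
    have : φ.symm ⟨bWord genG4 k, e ▸ (φ ⟨_, ha⟩).2⟩ = ⟨_, ha⟩ := by
      rw [MulEquiv.symm_apply_eq]
      exact Subtype.ext e.symm
    rw [this]
  · obtain ⟨x, rfl⟩ := φ.surjective b
    rw [φ.symm_apply_apply]
    change a11 * ((φ x : G4) : VP 4) = ((x : G4) : VP 4) * a11
    rw [hφ, cj]
    group
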